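/- **Setting.** Let $L$ be a smooth manifold (Hausdorff, second countable), let $\mathcal H(L)$ be its smooth vector fields and $\Lambda^p(L)$ its differential $p$-forms. Let $(\xi,J)$ be a Levi flat structure on $L$: $\xi\subset TL$ is a smooth integrable distribution of codimension $1$ ($[\xi,\xi]\subset\xi$) and $J:\xi\to\xi$ is a smooth bundle map with $J^2=-\mathrm{Id}$ which is an integrable complex structure on each leaf, i.e. $[JV,JW]-[V,W]-J[JV,W]-J[V,JW]=0$ for all vector fields $V,W$ tangent to $\xi$. Fix a defining couple $(\gamma,X)$ for $\xi$: a $1$-form $\gamma$ and a vector field $X$ with $\ker\gamma=\xi$ and $\gamma(X)=1$. **Notation.** * $\mathcal Z^p(L)=\{\alpha\in\Lambda^p(L):\iota_X\alpha=0\}$ (so $\mathcal Z^0(L)=C^\infty(L)$), and $\delta:\mathcal Z^p(L)\to\mathcal Z^{p+1}(L)$ is $\delta\alpha=d\alpha+\{\gamma,\alpha\}$ with $\{\gamma,\alpha\}=\mathcal L_X\gamma\wedge\alpha-\gamma\wedge\mathcal L_X\alpha$. * $\Lambda^{0,p}(\xi)\otimes\xi$ is the space of $\xi$-valued alternating $C^\infty(L)$-multilinear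 $p$-forms $P$ on vector fields tangent to $\xi$ with $P(V_1,\dots,JV_i,\dots,V_p)=-JP(V_1,\dots,V_p)$ for every $i$. * For $V,W$ tangent to $\xi$ put $(\bar\partial W)(V)=\frac12([V,W]+J[JV,W])$; in general $\bar\partial:\Lambda^{0,p}(\xi)\otimes\xi\to\Lambda^{0,p+1}(\xi)\otimes\xi$ is $$\bar\partial P(V_0,\dots,V_p)=\sum_i(-1)^i\,\bar\partial\bigl(P(V_0,\dots,\widehat{V_i},\dots,V_p)\bigr)(V_i)+\sum_{i<j}(-1)^{i+j}P\bigl(\tfrac12([V_i,V_j]-[JV_i,JV_j]),V_0,\dots,\widehat{V_i},\dots,\widehat{V_j},\dots,V_p\bigr).$$ * For $Y\in\mathcal H(L)$, $H_Y\in\Lambda^{0,1}(\xi)\otimes\xi$ is $H_Y(V)=\frac12\bigl(T_Y(V)+J\,T_Y(JV)\bigr)$ with $T_Y(V)=[V,Y]-\gamma([V,Y])X$; and $H=H_X$. * For a $p$-form $\alpha$, $\alpha^{0,p}$ is the $(0,p)$-part of its restriction to the leaves: $\alpha^{0,p}(V_1,\dots,V_p)=\alpha(V_1^{0,1},\dots,V_p^{0,1})$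 with $V^{0,1}=\frac12(V+\sqrt{-1}\,JV)$ and $\alpha$ extended $\mathbb C$-multilinearly. The product $\alpha^{0,p}\wedge H\in\Lambda^{0,p+1}(\xi)\otimes\xi$ is $$(\alpha^{0,p}\wedge H)(V_0,\dots,V_p)=(-1)^p\sum_i(-1)^i\,\alpha^{0,p}(V_0,\dots,\widehat{V_i},\dots,V_p)\cdot H(V_i),$$ where a complex function $f+\sqrt{-1}\,g$ acts on $\xi$ as $f+gJ$. * $\mathfrak z^p=\mathcal Z^p(L)\oplus\bigl(\Lambda^{0,p}(\xi)\otimes\xi\bigr)$ and $\mathfrak d^p:\mathfrak z^p\to\mathfrak z^{p+1}$, $\mathfrak d^p(\alpha,P)=\bigl(\delta\alpha,\ \bar\partial P+(-1)^{p+1}\alpha^{0,p}\wedge H\bigr)$. * $\mathcal A=\{(\beta,P)\in\mathfrak z^1:\ \delta\beta=0,\ \bar\partial P=-\beta^{0,1}\wedge H\}$. * $(\beta,P)\sim_{\mathcal G}(\beta',P')$ (equivalence modulo the infinitesimal action of diffeomorphisms) means: there is a vector field $Y\in\mathcal H(L)$ with $\beta-\beta'=\delta(\iota_Y\gamma)$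 and $P-P'=-H_Y$. **Theorem.** One has $\mathfrak d^1\circ\mathfrak d^0=0$, so that $H^1(\mathfrak z,\mathfrak d)=\ker\mathfrak d^1/\operatorname{im}\mathfrak d^0$ is defined. The pairs $(\delta(\iota_Y\gamma),-H_Y)$, $Y\in\mathcal H(L)$, form a linear subspace of $\mathcal A$, and $\mathcal A/\!\sim_{\mathcal G}$ is the quotient of $\mathcal A$ by this subspace. Every $(\beta,P)\in\mathcal A$ lies in $\ker\mathfrak d^1$, and sending the class of $(\beta,P)$ in $\mathcal A/\!\sim_{\mathcal G}$ to the class of $(\beta,P)$ in $H^1(\mathfrak z,\mathfrak d)$ is a well-defined linear isomorphism $$\mathcal A/\!\sim_{\mathcal G}\ \xrightarrow{\ \cong\ }\ H^1(\mathfrak z,\mathfrak d).$$ -/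

import Mathlib

open scoped Manifold ContDiff

noncomputable section

namespace LeviFlat

/-! ### Smooth functions and smooth vector fields on a manifold -/

section VectorFields

section
variable (E L : Type*) [NormedAddCommGroup E] [NormedSpace ℝ E]
  [TopologicalSpace L] [ChartedSpace E L]

/-- The algebra of real-valued smooth functions on `L`. -/
def SmoothFun : Type _ := C^∞⟮𝓘(ℝ, E), L; ℝ⟯

instance : CommRing (SmoothFun E L) := inferInstanceAs (CommRing C^∞⟮𝓘(ℝ, E), L; ℝ⟯)

instance : Algebra ℝ (SmoothFun E L) := inferInstanceAs (Algebra ℝ C^∞⟮𝓘(ℝ, E), L; ℝ⟯)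

instance : FunLike (SmoothFun E L) L ℝ := inferInstanceAs (FunLike C^∞⟮𝓘(ℝ, E), L; ℝ⟯ L ℝ)

/-- The space of smooth vector fields on `L`, i.e. smooth sections of the tangent bundle. -/
def VField [IsManifold 𝓘(ℝ, E) ∞ L] : Type _ :=
  Cₛ^∞⟮𝓘(ℝ, E); E, (TangentSpace 𝓘(ℝ, E) : L → Type _)⟯

variable [IsManifold 𝓘(ℝ, E) ∞ L]

instance : AddCommGroup (VField E L) :=
  inferInstanceAs (AddCommGroup Cₛ^∞⟮𝓘(ℝ, E); E, (TangentSpace 𝓘(ℝ, E) : L → Type _)⟯)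

instance : Module ℝ (VField E L) :=
  inferInstanceAs (Module ℝ Cₛ^∞⟮𝓘(ℝ, E); E, (TangentSpace 𝓘(ℝ, E) : L → Type _)⟯)

instance : DFunLike (VField E L) L (TangentSpace 𝓘(ℝ, E)) :=
  inferInstanceAs (DFunLike Cₛ^∞⟮𝓘(ℝ, E); E, (TangentSpace 𝓘(ℝ, E) : L → Type _)⟯ _ _)

end

variable {E L : Type*} [NormedAddCommGroup E] [NormedSpace ℝ E]
  [TopologicalSpace L] [ChartedSpace E L]

@[ext] theorem SmoothFun.ext {f g : SmoothFun E L} (h : ∀ x, f x = g x) : f = g :=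
  DFunLike.ext f g h

theorem SmoothFun.contMDiff (f : SmoothFun E L) : ContMDiff 𝓘(ℝ, E) 𝓘(ℝ, ℝ) ∞ f :=
  ContMDiffMap.contMDiff (I := 𝓘(ℝ, E)) f

theorem SmoothFun.mdifferentiableAt (f : SmoothFun E L) {x : L} :
    MDifferentiableAt 𝓘(ℝ, E) 𝓘(ℝ, ℝ) f x :=
  f.contMDiff.mdifferentiable (by simp) x

variable [IsManifold 𝓘(ℝ, E) ∞ L]

@[ext] theorem VField.ext {V W : VField E L} (h : ∀ x, V x = W x) : V = W :=
  DFunLike.ext V W h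

theorem VField.contMDiff (V : VField E L) : ContMDiff 𝓘(ℝ, E) 𝓘(ℝ, E).tangent ∞
    (fun x => (⟨x, V x⟩ : TangentBundle 𝓘(ℝ, E) L)) :=
  ContMDiffSection.contMDiff (I := 𝓘(ℝ, E)) (F := E)
    (V := (TangentSpace 𝓘(ℝ, E) : L → Type _)) V

theorem VField.mdifferentiableAt (V : VField E L) {x : L} : MDifferentiableAt 𝓘(ℝ, E)
    𝓘(ℝ, E).tangent (fun x => (⟨x, V x⟩ : TangentBundle 𝓘(ℝ, E) L)) x :=
  V.contMDiff.mdifferentiable (by simp) x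

/-- The vector field `fV`. -/
def VField.fsmul (f : SmoothFun E L) (V : VField E L) : VField E L :=
  (⟨fun x => f x • V x, f.contMDiff.smul_section V.contMDiff⟩ :
    Cₛ^∞⟮𝓘(ℝ, E); E, (TangentSpace 𝓘(ℝ, E) : L → Type _)⟯)

instance : Module (SmoothFun E L) (VField E L) where
  smul := VField.fsmul
  one_smul V := by ext x; exact one_smul ℝ (V x)
  mul_smul f g V := by ext x; exact mul_smul (f x) (g x) (V x)
  smul_zero f := by ext x; exact smul_zero (f x)
  smul_add f V W := by ext x; exact smul_add (f x) (V x) (W x)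
  add_smul f g V := by ext x; exact add_smul (f x) (g x) (V x)
  zero_smul V := by ext x; exact zero_smul ℝ (V x)

theorem smul_vfield_apply (f : SmoothFun E L) (V : VField E L) (x : L) :
    (f • V) x = f x • V x := rfl

instance : IsScalarTower ℝ (SmoothFun E L) (VField E L) where
  smul_assoc c f V := by ext x; exact smul_assoc c (f x) (V x)

/-- The derivative `V(f)` of a smooth function `f` along a vector field `V`. -/
def dirDeriv : VField E L →ₗ[ℝ] SmoothFun E L →ₗ[ℝ] SmoothFun E L :=
  LinearMap.mk₂ ℝ
    (fun V f => (⟨fun x => mvfderiv 𝓘(ℝ, E) f x (V x), by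
      have h : ContMDiff 𝓘(ℝ, E) 𝓘(ℝ, ℝ).tangent ∞
          (fun x => tangentMap 𝓘(ℝ, E) 𝓘(ℝ, ℝ) f ⟨x, V x⟩) :=
        (f.contMDiff.contMDiff_tangentMap (m := ∞) (by simp)).comp V.contMDiff
      exact (contMDiff_snd_tangentBundle_modelSpace ℝ 𝓘(ℝ, ℝ)).comp h⟩ :
        C^∞⟮𝓘(ℝ, E), L; ℝ⟯))
    (fun V W f => by ext x; exact (mvfderiv 𝓘(ℝ, E) f x).map_add (V x) (W x))
    (fun c V f => by ext x; exact (mvfderiv 𝓘(ℝ, E) f x).map_smul c (V x))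
    (fun V f g => by
      ext x
      have h := mvfderiv_add (I := 𝓘(ℝ, E)) (x := x) f.mdifferentiableAt g.mdifferentiableAt
      exact congrArg (fun T => T (V x)) h)
    (fun c V f => by
      ext x
      have h := mvfderiv_smul (I := 𝓘(ℝ, E)) (x := x) (a := fun _ : L => c)
        mdifferentiableAt_const f.mdifferentiableAt
      have h' := congrArg (fun T => T (V x)) h
      rw [mvfderiv_const] at h'
      refine h'.trans ?_
      change c * mvfderiv 𝓘(ℝ, E) f x (V x) + (0 : ℝ) * f x = c * mvfderiv 𝓘(ℝ, E) f x (V x)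
      ring)

theorem dirDeriv_apply (V : VField E L) (f : SmoothFun E L) (x : L) :
    dirDeriv V f x = mvfderiv 𝓘(ℝ, E) f x (V x) := rfl

theorem dirDeriv_smul_left (g : SmoothFun E L) (V : VField E L) (f : SmoothFun E L) :
    dirDeriv (g • V) f = g * dirDeriv V f := by
  ext x; exact (mvfderiv 𝓘(ℝ, E) f x).map_smul (g x) (V x)

theorem dirDeriv_mul (V : VField E L) (f g : SmoothFun E L) :
    dirDeriv V (f * g) = f * dirDeriv V g + dirDeriv V f * g := by
  ext x
  have h := mvfderiv_mul (I := 𝓘(ℝ, E)) (x := x) f.mdifferentiableAt g.mdifferentiableAt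
  have h' := congrArg (fun T => T (V x)) h
  refine h'.trans ?_
  change f x * _ + g x * _ = f x * _ + _ * g x
  rw [mul_comm (g x)]
  rfl

variable [CompleteSpace E]

/-- The Lie bracket `[V, W]` of vector fields. -/
def bracket : VField E L →ₗ[ℝ] VField E L →ₗ[ℝ] VField E L :=
  LinearMap.mk₂ ℝ
    (fun V W => (⟨fun x => VectorField.mlieBracket 𝓘(ℝ, E) V W x,
      haveI : IsManifold 𝓘(ℝ, E) (((⊤ : ℕ∞) : WithTop ℕ∞) + 1) L := by simpa
      haveI : IsManifold 𝓘(ℝ, E) (minSmoothness ℝ 2) L := by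
        rw [minSmoothness_of_isRCLikeNormedField]; infer_instance
      ContDiff.mlieBracket_vectorField (m := ⊤) (n := ⊤) V.contMDiff W.contMDiff (by simp)⟩ :
        Cₛ^∞⟮𝓘(ℝ, E); E, (TangentSpace 𝓘(ℝ, E) : L → Type _)⟯))
    (fun V V' W => by
      ext x; exact VectorField.mlieBracket_add_left V.mdifferentiableAt V'.mdifferentiableAt)
    (fun c V W => by
      ext x; exact VectorField.mlieBracket_const_smul_left V.mdifferentiableAt)
    (fun V W W' => by
      ext x; exact VectorField.mlieBracket_add_right W.mdifferentiableAt W'.mdifferentiableAt)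
    (fun c V W => by
      ext x; exact VectorField.mlieBracket_const_smul_right W.mdifferentiableAt)

theorem bracket_apply (V W : VField E L) (x : L) :
    bracket V W x = VectorField.mlieBracket 𝓘(ℝ, E) V W x := rfl

theorem bracket_swap (V W : VField E L) : bracket V W = -bracket W V := by
  ext x; exact VectorField.mlieBracket_swap_apply

theorem bracket_smul_right (V : VField E L) (f : SmoothFun E L) (W : VField E L) :
    bracket V (f • W) = dirDeriv V f • W + f • bracket V W := by
  ext x
  exact VectorField.mlieBracket_smul_right f.mdifferentiableAt W.mdifferentiableAt

theorem bracket_smul_left (f : SmoothFun E L) (V W : VField E L) :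
    bracket (f • V) W = f • bracket V W - dirDeriv W f • V := by
  rw [bracket_swap, bracket_smul_right, bracket_swap W V]; simp [sub_eq_add_neg, add_comm]

end VectorFields

/-! ### The Koszul formula -/

section Koszul

open AlternatingMap

variable {M N : Type*} [AddCommGroup M] [Module ℝ M] [AddCommGroup N] [Module ℝ N]

/-- `(v₀, …, v_p) ↦ ∑ᵢ (-1)ⁱ D(vᵢ) (P(v₀, …, v̂ᵢ, …, v_p))`. -/
def koszulDeriv (D : M →ₗ[ℝ] N →ₗ[ℝ] N) (p : ℕ) :
    (M [⋀^Fin p]→ₗ[ℝ] N) →ₗ[ℝ] (M [⋀^Fin (p + 1)]→ₗ[ℝ] N) where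
  toFun P := alternatizeUncurryFin
    { toFun := fun u => (D u).compAlternatingMap P
      map_add' := fun u v => by ext; simp
      map_smul' := fun c u => by ext; simp }
  map_add' P Q := by ext; simp [alternatizeUncurryFin_apply, Finset.sum_add_distrib]
  map_smul' c P := by ext; simp [alternatizeUncurryFin_apply, Finset.smul_sum, smul_comm _ c]

/-- For an antisymmetric bilinear `b`, this is
`(v₀, …, v_{p+1}) ↦ ∑_{i<j} (-1)^{i+j} P(b(vᵢ, vⱼ), v₀, …, v̂ᵢ, …, v̂ⱼ, …, v_{p+1})`,
see `koszulBracket_apply`. (Alternating twice counts every pair `i < j` two times, with the sign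
`-(-1)^{i+j}`; hence the factor `-1/2`.) -/
def koszulBracket (b : M →ₗ[ℝ] M →ₗ[ℝ] M) (p : ℕ) :
    (M [⋀^Fin (p + 1)]→ₗ[ℝ] N) →ₗ[ℝ] (M [⋀^Fin (p + 2)]→ₗ[ℝ] N) where
  toFun P := (-(1 / 2 : ℝ)) •
    alternatizeUncurryFin (alternatizeUncurryFinLM ∘ₗ b.compr₂ P.curryLeft)
  map_add' P Q := by
    ext
    simp [alternatizeUncurryFin_apply, Finset.sum_add_distrib]
    ring_nf
    module
  map_smul' c P := by
    ext
    simp [alternatizeUncurryFin_apply, Finset.smul_sum, smul_comm _ c]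

/-- The operator given by the Koszul formula
`(K P)(v₀, …, v_p) = ∑ᵢ (-1)ⁱ D(vᵢ) (P(v₀, …, v̂ᵢ, …, v_p))
  + ∑_{i<j} (-1)^{i+j} P(b(vᵢ, vⱼ), v₀, …, v̂ᵢ, …, v̂ⱼ, …, v_p)`. -/
def koszul (D : M →ₗ[ℝ] N →ₗ[ℝ] N) (b : M →ₗ[ℝ] M →ₗ[ℝ] M) :
    ∀ p : ℕ, (M [⋀^Fin p]→ₗ[ℝ] N) →ₗ[ℝ] (M [⋀^Fin (p + 1)]→ₗ[ℝ] N)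
  | 0 => koszulDeriv D 0
  | p + 1 => koszulDeriv D (p + 1) + koszulBracket b p

variable (D : M →ₗ[ℝ] N →ₗ[ℝ] N) (b : M →ₗ[ℝ] M →ₗ[ℝ] M)

theorem koszulDeriv_apply {p : ℕ} (P : M [⋀^Fin p]→ₗ[ℝ] N) (v : Fin (p + 1) → M) :
    koszulDeriv D p P v = ∑ i : Fin (p + 1), (-1) ^ (i : ℕ) • D (v i) (P (i.removeNth v)) := by
  simp [koszulDeriv, alternatizeUncurryFin_apply]

/-- The pairs `i < j` in `{0, …, p+1}` are written as `(i, j+1)` with `i ≤ j ≤ p`. -/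
theorem koszulBracket_apply (hb : ∀ u v, b u v = -b v u) {p : ℕ} (P : M [⋀^Fin (p + 1)]→ₗ[ℝ] N)
    (v : Fin (p + 2) → M) :
    koszulBracket b p P v = ∑ i : Fin (p + 1), ∑ j ≥ i, (-1 : ℤ) ^ (i + (j + 1) : ℕ) •
      P (Matrix.vecCons (b (v i.castSucc) (v j.succ)) (j.removeNth (i.castSucc.removeNth v))) := by
  simp only [koszulBracket, LinearMap.coe_mk, AddHom.coe_mk, AlternatingMap.smul_apply,
    alternatizeUncurryFin_alternatizeUncurryFinLM_comp_apply, Finset.smul_sum]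
  refine Finset.sum_congr rfl fun i _ => Finset.sum_congr rfl fun j _ => ?_
  simp only [LinearMap.compr₂_apply, AlternatingMap.curryLeft_apply_apply]
  rw [hb (v j.succ) (v i.castSucc), ← neg_one_smul ℝ (b (v i.castSucc) (v j.succ)),
    AlternatingMap.map_vecCons_smul, ← Int.cast_smul_eq_zsmul ℝ, ← Int.cast_smul_eq_zsmul ℝ]
  push_cast
  have hpow : (-1 : ℝ) ^ ((i : ℕ) + ((j : ℕ) + 1)) = -((-1) ^ (i : ℕ) * (-1) ^ (j : ℕ)) := by
    ring
  rw [hpow, pow_add]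
  module

theorem alternatizeUncurryFin_cons {A M N : Type*} [CommRing A] [AddCommGroup M] [Module A M]
    [AddCommGroup N] [Module A N] {n : ℕ} (f : M →ₗ[A] M [⋀^Fin (n + 1)]→ₗ[A] N) (w : M)
    (v : Fin (n + 1) → M) :
    alternatizeUncurryFin f (Matrix.vecCons w v) = f w v -
      ∑ j : Fin (n + 1), (-1) ^ (j : ℕ) • f (v j) (Matrix.vecCons w (j.removeNth v)) := by
  rw [alternatizeUncurryFin_apply, Fin.sum_univ_succ]
  have h : ∀ j : Fin (n + 1), Fin.removeNth j.succ (Matrix.vecCons w v)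
      = Matrix.vecCons w (j.removeNth v) := by
    intro j; ext k
    refine Fin.cases ?_ (fun k => ?_) k <;> simp [Fin.removeNth]
  simp [h, pow_succ, Finset.sum_neg_distrib, sub_eq_add_neg]

theorem alternatizeUncurryFin_zero_cons {A M N : Type*} [CommRing A] [AddCommGroup M] [Module A M]
    [AddCommGroup N] [Module A N] (f : M →ₗ[A] M [⋀^Fin 0]→ₗ[A] N) (w : M) (v : Fin 0 → M) :
    alternatizeUncurryFin f (Matrix.vecCons w v) = f w v := by
  simp [alternatizeUncurryFin_apply, Subsingleton.elim (Fin.tail (Matrix.vecCons w v)) v]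

theorem map_vecCons_vecCons_swap {p : ℕ} (P : M [⋀^Fin (p + 2)]→ₗ[ℝ] N) (u w : M)
    (x : Fin p → M) :
    P (Matrix.vecCons u (Matrix.vecCons w x)) = -P (Matrix.vecCons w (Matrix.vecCons u x)) := by
  rw [← P.map_swap (Matrix.vecCons w (Matrix.vecCons u x)) (i := 0) (j := 1) (by simp)]
  congr 1
  ext k
  refine Fin.cases ?_ (fun k => Fin.cases ?_ (fun k => ?_) k) k
  · simp
  · simp [Function.comp]
  · have h0 : k.succ.succ ≠ 0 := Fin.succ_ne_zero _
    have h1 : k.succ.succ ≠ 1 := by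
      rw [← Fin.succ_zero_eq_one]; exact fun h => Fin.succ_ne_zero _ (Fin.succ_injective _ h)
    simp [Function.comp, Equiv.swap_apply_of_ne_of_ne h0 h1]

theorem koszulBracket_cons (hb : ∀ u v, b u v = -b v u) {p : ℕ} (P : M [⋀^Fin (p + 2)]→ₗ[ℝ] N)
    (w : M) (v : Fin (p + 2) → M) :
    koszulBracket b (p + 1) P (Matrix.vecCons w v) =
      - (∑ j : Fin (p + 2), (-1) ^ (j : ℕ) • P (Matrix.vecCons (b w (v j)) (j.removeNth v)))
      - koszulBracket b p (P.curryLeft w) v := by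
  have hneg : ∀ (u u' : M) (x : Fin (p + 1) → M),
      P (Matrix.vecCons (b u u') x) = -P (Matrix.vecCons (b u' u) x) := by
    intro u u' x
    rw [hb u u', ← neg_one_smul ℝ (b u' u), AlternatingMap.map_vecCons_smul, neg_one_smul]
  simp only [koszulBracket, LinearMap.coe_mk, AddHom.coe_mk, AlternatingMap.smul_apply]
  rw [alternatizeUncurryFin_cons]
  simp only [LinearMap.comp_apply, alternatizeUncurryFinLM_apply, alternatizeUncurryFin_cons]
  simp only [alternatizeUncurryFin_apply, LinearMap.comp_apply, alternatizeUncurryFinLM_apply,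
    LinearMap.compr₂_apply, AlternatingMap.curryLeft_apply_apply]
  simp only [map_vecCons_vecCons_swap P w, hneg _ w]
  simp only [smul_sub, smul_neg, Finset.sum_sub_distrib, Finset.sum_neg_distrib, Finset.smul_sum]
  simp only [← Finset.smul_sum]
  module

/-- Cartan's formula for the Koszul operator. -/
theorem koszul_cons (hb : ∀ u v, b u v = -b v u) {p : ℕ} (P : M [⋀^Fin (p + 1)]→ₗ[ℝ] N)
    (w : M) (v : Fin (p + 1) → M) :
    koszul D b (p + 1) P (Matrix.vecCons w v) = D w (P v)
      - ∑ j : Fin (p + 1), (-1) ^ (j : ℕ) • P (Matrix.vecCons (b w (v j)) (j.removeNth v))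
      - koszul D b p (P.curryLeft w) v := by
  have hD : koszulDeriv D (p + 1) P (Matrix.vecCons w v) =
      D w (P v) - koszulDeriv D p (P.curryLeft w) v := by
    simp only [koszulDeriv, LinearMap.coe_mk, AddHom.coe_mk, alternatizeUncurryFin_cons]
    simp [alternatizeUncurryFin_apply]
  cases p with
  | zero =>
    simp only [koszul, LinearMap.add_apply, AlternatingMap.add_apply, hD]
    simp only [koszulBracket, LinearMap.coe_mk, AddHom.coe_mk, AlternatingMap.smul_apply,
      alternatizeUncurryFin_cons]
    simp only [alternatizeUncurryFin_apply, LinearMap.comp_apply, alternatizeUncurryFinLM_apply,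
      LinearMap.compr₂_apply, AlternatingMap.curryLeft_apply_apply]
    simp only [Fin.sum_univ_succ, Fin.sum_univ_zero]
    simp
    rw [hb (v 0) w, ← neg_one_smul ℝ (b w (v 0)), AlternatingMap.map_vecCons_smul]
    module
  | succ p =>
    simp only [koszul, LinearMap.add_apply, AlternatingMap.add_apply, hD,
      koszulBracket_cons b hb]
    abel

theorem koszul_comp (ρ : N →ₗ[ℝ] N) {p : ℕ} (Q : M [⋀^Fin p]→ₗ[ℝ] N) (v : Fin (p + 1) → M) :
    koszul D b p (ρ.compAlternatingMap Q) v = ρ (koszul D b p Q v) +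
      ∑ j : Fin (p + 1), (-1) ^ (j : ℕ) •
        (D (v j) (ρ (Q (j.removeNth v))) - ρ (D (v j) (Q (j.removeNth v)))) := by
  have hD : koszulDeriv D p (ρ.compAlternatingMap Q) v = ρ (koszulDeriv D p Q v) +
      ∑ j : Fin (p + 1), (-1) ^ (j : ℕ) •
        (D (v j) (ρ (Q (j.removeNth v))) - ρ (D (v j) (Q (j.removeNth v)))) := by
    simp [koszulDeriv_apply, map_sum, smul_sub, Finset.sum_sub_distrib]
  cases p with
  | zero => simpa only [koszul] using hD
  | succ p =>
    have hB : koszulBracket b p (ρ.compAlternatingMap Q) v = ρ (koszulBracket b p Q v) := by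
      simp [koszulBracket, alternatizeUncurryFin_apply, map_sum]
    simp only [koszul, LinearMap.add_apply, AlternatingMap.add_apply, hD, hB, map_add]
    abel

/-- If the linear maps `ρM : M → M` and `ρN : N → N` are compatible with `D`, `b` and `P` in the
following sense, then the Koszul operator is compatible with them in its first variable. -/
theorem koszul_cons_compat (hb : ∀ u v, b u v = -b v u) (ρM : M →ₗ[ℝ] M) (ρN : N →ₗ[ℝ] N)
    (h1 : ∀ w n, D (ρM w) n = ρN (D w n)) {p : ℕ} (P : M [⋀^Fin (p + 1)]→ₗ[ℝ] N)
    (h2 : ∀ (u w : M) (x : Fin p → M), P (Matrix.vecCons (b (ρM w) u) x) =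
      ρN (P (Matrix.vecCons (b w u) x)) -
        (D u (ρN (P (Matrix.vecCons w x))) - ρN (D u (P (Matrix.vecCons w x)))))
    (h3 : ∀ (w : M) (x : Fin p → M),
      P (Matrix.vecCons (ρM w) x) = ρN (P (Matrix.vecCons w x)))
    (w : M) (v : Fin (p + 1) → M) :
    koszul D b (p + 1) P (Matrix.vecCons (ρM w) v) =
      ρN (koszul D b (p + 1) P (Matrix.vecCons w v)) := by
  have h3' : P.curryLeft (ρM w) = ρN.compAlternatingMap (P.curryLeft w) := by
    ext x; exact h3 w x
  rw [koszul_cons D b hb, koszul_cons D b hb, h3', koszul_comp]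
  simp only [h1, h2, map_sub, map_sum, AlternatingMap.curryLeft_apply_apply, map_zsmul, smul_sub,
    Finset.sum_sub_distrib]
  simp
  abel

theorem koszul_zero_cons (P : M [⋀^Fin 0]→ₗ[ℝ] N) (w : M) (v : Fin 0 → M) :
    koszul D b 0 P (Matrix.vecCons w v) = D w (P v) := by
  simp [koszul, koszulDeriv_apply, Subsingleton.elim (Fin.tail (Matrix.vecCons w v)) v]

/-- A property of the first variable of an alternating map holds in every variable. -/
theorem map_update_of_cons {p : ℕ} (f : M [⋀^Fin (p + 1)]→ₗ[ℝ] N) (ρM : M → M)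
    (ρN : N →ₗ[ℝ] N)
    (h : ∀ (w : M) (x : Fin p → M), f (Matrix.vecCons (ρM w) x) = ρN (f (Matrix.vecCons w x)))
    (v : Fin (p + 1) → M) (i : Fin (p + 1)) (w : M) :
    f (Function.update v i (ρM w)) = ρN (f (Function.update v i w)) := by
  have key : ∀ u, f (Function.update v i u) =
      (-1) ^ (i : ℕ) • f (Matrix.vecCons u (i.removeNth v)) := by
    intro u
    rw [← AlternatingMap.map_insertNth, Fin.insertNth_removeNth]
  rw [key, key, h, map_zsmul]

/-- An `ℝ`-multilinear alternating map which is homogeneous over `A`, seen as an `A`-multilinear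
one. -/
def ofReal {A : Type*} [CommRing A] [Module A M] [Module A N] {p : ℕ} (f : M [⋀^Fin p]→ₗ[ℝ] N)
    (h : ∀ (v : Fin p → M) (i : Fin p) (a : A) (w : M),
      f (Function.update v i (a • w)) = a • f (Function.update v i w)) :
    M [⋀^Fin p]→ₗ[A] N where
  toFun := f
  map_update_add' := by
    intro inst v i x y
    exact f.map_update_add v i x y
  map_update_smul' := by
    intro inst v i a x
    rw [Subsingleton.elim inst (instDecidableEqFin p)]
    exact h v i a x
  map_eq_zero_of_eq' := f.map_eq_zero_of_eq'

@[simp] theorem ofReal_apply {A : Type*} [CommRing A] [Module A M] [Module A N] {p : ℕ}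
    (f : M [⋀^Fin p]→ₗ[ℝ] N) (h : ∀ (v : Fin p → M) (i : Fin p) (a : A) (w : M),
      f (Function.update v i (a • w)) = a • f (Function.update v i w)) (v : Fin p → M) :
    ofReal f h v = f v := rfl

variable {A : Type*} [CommRing A] [Algebra ℝ A] [Module A M] [IsScalarTower ℝ A M]
  [Module A N] [IsScalarTower ℝ A N]

/-- An `A`-multilinear alternating map, seen as an `ℝ`-multilinear one. -/
def toReal {p : ℕ} (P : M [⋀^Fin p]→ₗ[A] N) : M [⋀^Fin p]→ₗ[ℝ] N :=
  { P.toMultilinearMap.restrictScalars ℝ with map_eq_zero_of_eq' := P.map_eq_zero_of_eq' }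

@[simp] theorem toReal_apply {p : ℕ} (P : M [⋀^Fin p]→ₗ[A] N) (v : Fin p → M) :
    toReal P v = P v := rfl

theorem koszul_smul_zero (h1 : ∀ (a : A) (w : M) (n : N), D (a • w) n = a • D w n)
    (P : M [⋀^Fin 0]→ₗ[A] N) (v : Fin 1 → M) (i : Fin 1) (a : A) (w : M) :
    koszul D b 0 (toReal P) (Function.update v i (a • w)) =
      a • koszul D b 0 (toReal P) (Function.update v i w) :=
  map_update_of_cons (koszul D b 0 (toReal P)) (fun w => a • w) (DistribSMul.toLinearMap ℝ N a)
    (fun w x => by simp [koszul_zero_cons, h1]) v i w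

theorem koszul_smul_succ (hb : ∀ u v, b u v = -b v u)
    (h1 : ∀ (a : A) (w : M) (n : N), D (a • w) n = a • D w n) {p : ℕ}
    (P : M [⋀^Fin (p + 1)]→ₗ[A] N)
    (h2 : ∀ (a : A) (u w : M) (x : Fin p → M), P (Matrix.vecCons (b (a • w) u) x) =
        a • P (Matrix.vecCons (b w u) x) -
          (D u (a • P (Matrix.vecCons w x)) - a • D u (P (Matrix.vecCons w x))))
    (v : Fin (p + 2) → M) (i : Fin (p + 2)) (a : A) (w : M) :
    koszul D b (p + 1) (toReal P) (Function.update v i (a • w)) =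
      a • koszul D b (p + 1) (toReal P) (Function.update v i w) :=
  map_update_of_cons (koszul D b (p + 1) (toReal P)) (fun w => a • w)
    (DistribSMul.toLinearMap ℝ N a)
    (koszul_cons_compat D b hb (DistribSMul.toLinearMap ℝ M a) (DistribSMul.toLinearMap ℝ N a)
      (h1 a) (toReal P) (h2 a) (fun w x => P.map_vecCons_smul x a w)) v i w

end Koszul

/-! ### Differential forms on `L` -/

section Forms

open AlternatingMap

section
variable (E L : Type*) [NormedAddCommGroup E] [NormedSpace ℝ E]
  [TopologicalSpace L] [ChartedSpace E L] [IsManifold 𝓘(ℝ, E) ∞ L]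

/-- Differential `p`-forms on `L`: alternating `C^∞(L)`-multilinear maps from vector fields to
smooth functions. -/
abbrev Form (p : ℕ) : Type _ := VField E L [⋀^Fin p]→ₗ[SmoothFun E L] SmoothFun E L

end

variable {E L : Type*} [NormedAddCommGroup E] [NormedSpace ℝ E]
  [TopologicalSpace L] [ChartedSpace E L] [IsManifold 𝓘(ℝ, E) ∞ L]

/-- The interior product `ι_X`. -/
def interior (X : VField E L) {p : ℕ} : Form E L (p + 1) →ₗ[ℝ] Form E L p where
  toFun α := α.curryLeft X
  map_add' _ _ := rfl
  map_smul' _ _ := rfl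

theorem interior_apply (X : VField E L) {p : ℕ} (α : Form E L (p + 1)) (v : Fin p → VField E L) :
    interior X α v = α (Matrix.vecCons X v) := rfl

theorem interior_interior (X : VField E L) {p : ℕ} (α : Form E L (p + 2)) :
    interior X (interior X α) = 0 := by
  ext1 v
  exact α.map_eq_zero_of_eq _ (i := 0) (j := 1) rfl (by simp)

theorem dirDeriv_one (V : VField E L) : dirDeriv V (1 : SmoothFun E L) = 0 := by
  have h := dirDeriv_mul V (1 : SmoothFun E L) 1
  simpa using h

/-- `θ ∧ α` for a `1`-form `θ` and a `p`-form `α`: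
`(θ ∧ α)(V₀, …, V_p) = ∑ᵢ (-1)ⁱ θ(Vᵢ) α(V₀, …, V̂ᵢ, …, V_p)`. -/
def wedgeOne (θ : Form E L 1) {p : ℕ} : Form E L p →ₗ[ℝ] Form E L (p + 1) where
  toFun α := alternatizeUncurryFin
    { toFun := fun u => θ ![u] • α
      map_add' := fun u v => by
        have h : θ ![u + v] = θ ![u] + θ ![v] := θ.map_vecCons_add ![] u v
        rw [h, add_smul]
      map_smul' := fun c u => by
        have h : θ ![c • u] = c • θ ![u] := θ.map_vecCons_smul ![] c u
        rw [h, smul_assoc]; rfl }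
  map_add' α β := by
    ext1 v
    simp [alternatizeUncurryFin_apply, Finset.sum_add_distrib]
  map_smul' c α := by
    ext1 v
    simp [alternatizeUncurryFin_apply, Finset.smul_sum, smul_comm _ c]

theorem wedgeOne_apply (θ : Form E L 1) {p : ℕ} (α : Form E L p) (v : Fin (p + 1) → VField E L) :
    wedgeOne θ α v = ∑ i : Fin (p + 1), (-1) ^ (i : ℕ) • (θ ![v i] * α (i.removeNth v)) := by
  simp [wedgeOne, alternatizeUncurryFin_apply]

/-- `ι_X (θ ∧ α) = θ(X) α - θ ∧ ι_X α`. -/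
theorem interior_wedgeOne_succ (θ : Form E L 1) (X : VField E L) {p : ℕ}
    (α : Form E L (p + 1)) :
    interior X (wedgeOne θ α) = θ ![X] • α - wedgeOne θ (interior X α) := by
  ext1 v
  rw [interior_apply, AlternatingMap.sub_apply, AlternatingMap.smul_apply, wedgeOne_apply θ _ v]
  exact alternatizeUncurryFin_cons _ X v

theorem interior_wedgeOne_zero (θ : Form E L 1) (X : VField E L) (f : Form E L 0) :
    interior X (wedgeOne θ f) = θ ![X] • f := by
  ext1 v
  exact alternatizeUncurryFin_zero_cons _ X v

variable [CompleteSpace E]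

/-- The exterior derivative, by the invariant formula
`dα(V₀, …, V_p) = ∑ᵢ (-1)ⁱ Vᵢ(α(V₀, …, V̂ᵢ, …, V_p))
  + ∑_{i<j} (-1)^{i+j} α([Vᵢ, Vⱼ], V₀, …, V̂ᵢ, …, V̂ⱼ, …, V_p)`. -/
def extD (p : ℕ) : Form E L p →ₗ[ℝ] Form E L (p + 1) where
  toFun α := ofReal (koszul dirDeriv bracket p (toReal α)) (by
    cases p with
    | zero => exact koszul_smul_zero _ _ dirDeriv_smul_left α
    | succ p =>
      refine koszul_smul_succ _ _ bracket_swap dirDeriv_smul_left α ?_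
      intro a u w x
      have h : bracket (a • w) u = a • bracket w u + (-dirDeriv u a) • w := by
        rw [bracket_smul_left, neg_smul, sub_eq_add_neg]
      rw [h, α.map_vecCons_add, α.map_vecCons_smul, α.map_vecCons_smul]
      simp only [smul_eq_mul, dirDeriv_mul]
      ring)
  map_add' α β := by
    have h : toReal (α + β) = toReal α + toReal β := rfl
    ext1 v
    simp only [ofReal_apply, h, map_add, AlternatingMap.add_apply]
  map_smul' c α := by
    have h : toReal (c • α) = c • toReal α := rfl
    ext1 v
    simp only [ofReal_apply, h, map_smul, AlternatingMap.smul_apply, RingHom.id_apply]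

/-- The Lie derivative `ℒ_X = ι_X d + d ι_X` of forms (with `ι_X = 0` on functions). -/
def lieD (X : VField E L) : ∀ p : ℕ, Form E L p →ₗ[ℝ] Form E L p
  | 0 => interior X ∘ₗ extD 0
  | p + 1 => interior X ∘ₗ extD (p + 1) + extD p ∘ₗ interior X

/-- The forms `α` with `ι_X α = 0`. -/
def horizontal (X : VField E L) : ∀ p : ℕ, Submodule ℝ (Form E L p)
  | 0 => ⊤
  | _ + 1 => LinearMap.ker (interior X)

/-- `δα = dα + {γ, α}`, where `{γ, α} = ℒ_X γ ∧ α - γ ∧ ℒ_X α`. -/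
def deltaForm (γ : Form E L 1) (X : VField E L) (p : ℕ) : Form E L p →ₗ[ℝ] Form E L (p + 1) :=
  extD p + (wedgeOne (lieD X 1 γ) - wedgeOne γ ∘ₗ lieD X p)

theorem lieD_one_apply_self (γ : Form E L 1) (X : VField E L) (h : γ ![X] = 1) :
    lieD X 1 γ ![X] = 0 := by
  have h1 : extD 1 γ ![X, X] = 0 :=
    (extD 1 γ).map_eq_zero_of_eq _ (i := 0) (j := 1) rfl (by simp)
  have h2 : extD 0 (interior X γ) ![X] = 0 := by
    change koszul dirDeriv bracket 0 (toReal (interior X γ)) ![X] = 0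
    rw [koszul_zero_cons]
    change dirDeriv X (γ ![X]) = 0
    rw [h, dirDeriv_one]
  change extD 1 γ ![X, X] + extD 0 (interior X γ) ![X] = 0
  rw [h1, h2, add_zero]

theorem deltaForm_mem (γ : Form E L 1) (X : VField E L) (h : γ ![X] = 1) (p : ℕ)
    (α : Form E L p) (hα : α ∈ horizontal X p) : deltaForm γ X p α ∈ horizontal X (p + 1) := by
  change interior X (extD p α + (wedgeOne (lieD X 1 γ) α - wedgeOne γ (lieD X p α))) = 0
  rw [map_add, map_sub]
  cases p with
  | zero =>
    rw [interior_wedgeOne_zero, interior_wedgeOne_zero, h, lieD_one_apply_self γ X h, zero_smul,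
      one_smul]
    change interior X (extD 0 α) + (0 - interior X (extD 0 α)) = 0
    abel
  | succ p =>
    have hα' : interior X α = 0 := hα
    have hL : lieD X (p + 1) α = interior X (extD (p + 1) α) := by
      change interior X (extD (p + 1) α) + extD p (interior X α) = _
      rw [hα', _root_.map_zero, add_zero]
    rw [interior_wedgeOne_succ, interior_wedgeOne_succ, h, lieD_one_apply_self γ X h, zero_smul,
      one_smul, hL, interior_interior, hα', _root_.map_zero, _root_.map_zero]
    abel

end Forms

/-! ### Levi flat structures -/

section LeviFlatStructures

section
variable (E L : Type*) [NormedAddCommGroup E] [NormedSpace ℝ E] [CompleteSpace E]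
  [TopologicalSpace L] [ChartedSpace E L] [IsManifold 𝓘(ℝ, E) ∞ L]

/-- An integrable smooth distribution `ξ` of codimension `1` on `L` together with a smooth almost
complex structure `J : ξ → ξ` on its leaves. Smoothness of `ξ` means that `ξ` is locally (hence,
by cutting off, globally) generated by smooth vector fields; integrability of `ξ` is expressed by
the Frobenius condition `[ξ, ξ] ⊆ ξ`. -/
structure AlmostLeviFlat where
  /-- the distribution -/
  ξ : ∀ x : L, Submodule ℝ (TangentSpace 𝓘(ℝ, E) x)
  codim_one : ∀ x, Module.finrank ℝ (TangentSpace 𝓘(ℝ, E) x ⧸ ξ x) = 1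
  smooth : ∀ x, ∀ v ∈ ξ x, ∃ V : VField E L, (∀ y, V y ∈ ξ y) ∧ V x = v
  involutive : ∀ V W : VField E L, (∀ x, V x ∈ ξ x) → (∀ x, W x ∈ ξ x) →
    ∀ x, bracket V W x ∈ ξ x
  /-- the almost complex structure -/
  J : ∀ x : L, ξ x →ₗ[ℝ] ξ x
  J_sq : ∀ x (v : ξ x), J x (J x v) = -v
  J_smooth : ∀ (V : VField E L) (hV : ∀ x, V x ∈ ξ x),
    ContMDiff 𝓘(ℝ, E) 𝓘(ℝ, E).tangent ∞
      (fun x => (⟨x, ((J x ⟨V x, hV x⟩ : ξ x) : TangentSpace 𝓘(ℝ, E) x)⟩ :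
        TangentBundle 𝓘(ℝ, E) L))

end

variable {E L : Type*} [NormedAddCommGroup E] [NormedSpace ℝ E] [CompleteSpace E]
  [TopologicalSpace L] [ChartedSpace E L] [IsManifold 𝓘(ℝ, E) ∞ L]

namespace AlmostLeviFlat

variable (S : AlmostLeviFlat E L)

/-- The vector fields tangent to `ξ`. -/
def sections : Submodule (SmoothFun E L) (VField E L) where
  carrier := {V | ∀ x, V x ∈ S.ξ x}
  add_mem' hV hW x := (S.ξ x).add_mem (hV x) (hW x)
  zero_mem' x := (S.ξ x).zero_mem
  smul_mem' f _ hV x := (S.ξ x).smul_mem (f x) (hV x)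

/-- The `C^∞(L)`-module of the vector fields tangent to `ξ`. -/
def TField : Type _ := S.sections

instance : AddCommGroup S.TField := inferInstanceAs (AddCommGroup S.sections)

instance : Module (SmoothFun E L) S.TField := inferInstanceAs (Module (SmoothFun E L) S.sections)

instance : Module ℝ S.TField := inferInstanceAs (Module ℝ S.sections)

instance : IsScalarTower ℝ (SmoothFun E L) S.TField :=
  inferInstanceAs (IsScalarTower ℝ (SmoothFun E L) S.sections)

/-- The inclusion of the vector fields tangent to `ξ` into all vector fields. -/
def incl : S.TField →ₗ[SmoothFun E L] VField E L := S.sections.subtype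

variable {S} in
/-- A vector field with values in `ξ`, as a vector field tangent to `ξ`. -/
def TField.mk (V : VField E L) (hV : ∀ x, V x ∈ S.ξ x) : S.TField := (⟨V, hV⟩ : S.sections)

theorem incl_mem (V : S.TField) (x : L) : S.incl V x ∈ S.ξ x := V.2 x

variable {S} in
@[simp] theorem incl_mk (V : VField E L) (hV : ∀ x, V x ∈ S.ξ x) :
    S.incl (TField.mk V hV) = V := rfl

variable {S} in
theorem TField.ext {V W : S.TField} (h : S.incl V = S.incl W) : V = W := Subtype.ext h

theorem incl_smul (c : ℝ) (V : S.TField) : S.incl (c • V) = c • S.incl V := rfl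

/-- `J`, acting on the vector fields tangent to `ξ`. -/
def Jsec : S.TField →ₗ[SmoothFun E L] S.TField where
  toFun V := TField.mk
    (⟨fun x => (S.J x ⟨S.incl V x, S.incl_mem V x⟩ : S.ξ x), S.J_smooth _ (S.incl_mem V)⟩ :
      Cₛ^∞⟮𝓘(ℝ, E); E, (TangentSpace 𝓘(ℝ, E) : L → Type _)⟯)
    fun x => (S.J x ⟨S.incl V x, S.incl_mem V x⟩).2
  map_add' V W := by
    refine TField.ext ?_
    ext x
    exact congrArg Subtype.val
      ((S.J x).map_add ⟨S.incl V x, S.incl_mem V x⟩ ⟨S.incl W x, S.incl_mem W x⟩)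
  map_smul' f V := by
    refine TField.ext ?_
    ext x
    exact congrArg Subtype.val ((S.J x).map_smul (f x) ⟨S.incl V x, S.incl_mem V x⟩)

theorem Jsec_apply (V : S.TField) (x : L) :
    S.incl (S.Jsec V) x = (S.J x ⟨S.incl V x, S.incl_mem V x⟩ : S.ξ x) := rfl

@[simp] theorem Jsec_Jsec (V : S.TField) : S.Jsec (S.Jsec V) = -V := by
  refine TField.ext ?_
  ext x
  exact congrArg Subtype.val (S.J_sq x ⟨S.incl V x, S.incl_mem V x⟩)

/-- The Lie bracket of vector fields tangent to `ξ`. -/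
def br : S.TField →ₗ[ℝ] S.TField →ₗ[ℝ] S.TField :=
  LinearMap.mk₂ ℝ (fun V W => TField.mk (bracket (S.incl V) (S.incl W))
      (S.involutive _ _ (S.incl_mem V) (S.incl_mem W)))
    (fun V V' W => TField.ext (by simp))
    (fun c V W => TField.ext (by simp))
    (fun V W W' => TField.ext (by simp))
    (fun c V W => TField.ext (by simp))

theorem incl_br (V W : S.TField) : S.incl (S.br V W) = bracket (S.incl V) (S.incl W) := rfl

theorem br_swap (V W : S.TField) : S.br V W = -S.br W V :=
  TField.ext (by rw [map_neg, incl_br, incl_br, bracket_swap])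

theorem br_smul_right (V : S.TField) (f : SmoothFun E L) (W : S.TField) :
    S.br V (f • W) = dirDeriv (S.incl V) f • W + f • S.br V W :=
  TField.ext (by simp only [map_add, map_smul, incl_br, bracket_smul_right])

theorem br_smul_left (f : SmoothFun E L) (V W : S.TField) :
    S.br (f • V) W = f • S.br V W - dirDeriv (S.incl W) f • V :=
  TField.ext (by simp only [map_sub, map_smul, incl_br, bracket_smul_left])

end AlmostLeviFlat

variable (E L) in
/-- A Levi flat structure `(ξ, J)`: the almost complex structure `J` on the leaves of `ξ` is
integrable, i.e. its Nijenhuis tensor `[JV, JW] - [V, W] - J[JV, W] - J[V, JW]` vanishes. -/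
structure LeviFlatStructure extends AlmostLeviFlat E L where
  nijenhuis : ∀ V W : toAlmostLeviFlat.TField,
    toAlmostLeviFlat.br (toAlmostLeviFlat.Jsec V) (toAlmostLeviFlat.Jsec W)
      - toAlmostLeviFlat.br V W
      - toAlmostLeviFlat.Jsec (toAlmostLeviFlat.br (toAlmostLeviFlat.Jsec V) W)
      - toAlmostLeviFlat.Jsec (toAlmostLeviFlat.br V (toAlmostLeviFlat.Jsec W)) = 0

namespace LeviFlatStructure

variable (S : LeviFlatStructure E L)

theorem smul_Jsec (c : ℝ) (V : S.TField) : S.Jsec (c • V) = c • S.Jsec V :=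
  (S.Jsec.restrictScalars ℝ).map_smul c V

/-- The space `Λ^{0,p}(ξ) ⊗ ξ` of `ξ`-valued forms `P` of type `(0,p)` along the leaves:
`P(V₁, …, JVᵢ, …, V_p) = -J P(V₁, …, V_p)` for every `i`. -/
def zeroForm (p : ℕ) : Submodule ℝ (S.TField [⋀^Fin p]→ₗ[SmoothFun E L] S.TField) where
  carrier := {P | ∀ (v : Fin p → S.TField) (i : Fin p),
    P (Function.update v i (S.Jsec (v i))) = -S.Jsec (P v)}
  add_mem' hP hQ v i := by
    rw [AlternatingMap.add_apply, AlternatingMap.add_apply, hP, hQ, map_add, neg_add]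
  zero_mem' v i := by simp
  smul_mem' c P hP v i := by
    rw [AlternatingMap.smul_apply, AlternatingMap.smul_apply, hP, S.smul_Jsec, smul_neg]

theorem mem_zeroForm_zero (P : S.TField [⋀^Fin 0]→ₗ[SmoothFun E L] S.TField) :
    P ∈ S.zeroForm 0 := fun _ i => i.elim0

theorem zeroForm_cons {p : ℕ} {P : S.TField [⋀^Fin (p + 1)]→ₗ[SmoothFun E L] S.TField}
    (hP : P ∈ S.zeroForm (p + 1)) (w : S.TField) (x : Fin p → S.TField) :
    P (Matrix.vecCons (S.Jsec w) x) = -S.Jsec (P (Matrix.vecCons w x)) := by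
  rw [← hP (Matrix.vecCons w x) 0]
  congr 1
  ext1 k
  refine Fin.cases ?_ (fun k => ?_) k <;> simp

theorem mem_zeroForm_of_cons {p : ℕ}
    {P : S.TField [⋀^Fin (p + 1)]→ₗ[SmoothFun E L] S.TField}
    (hP : ∀ (w : S.TField) (x : Fin p → S.TField),
      P (Matrix.vecCons (S.Jsec w) x) = -S.Jsec (P (Matrix.vecCons w x))) :
    P ∈ S.zeroForm (p + 1) := by
  intro v i
  have h := map_update_of_cons (toReal P) S.Jsec (-(S.Jsec.restrictScalars ℝ)) hP v i (v i)
  rw [Function.update_eq_self] at h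
  exact h

/-! #### The operator `∂̄` -/

/-- `(V, W) ↦ (∂̄W)(V) = ½([V, W] + J[JV, W])` for vector fields tangent to `ξ`. -/
def dbarVec : S.TField →ₗ[ℝ] S.TField →ₗ[ℝ] S.TField :=
  LinearMap.mk₂ ℝ (fun V W => (1 / 2 : ℝ) • (S.br V W + S.Jsec (S.br (S.Jsec V) W)))
    (fun V V' W => by simp only [map_add, LinearMap.add_apply]; module)
    (fun c V W => by
      simp only [map_smul, LinearMap.smul_apply, S.smul_Jsec]; module)
    (fun V W W' => by simp only [map_add]; module)
    (fun c V W => by simp only [map_smul, S.smul_Jsec]; module)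

theorem dbarVec_apply (V W : S.TField) :
    S.dbarVec V W = (1 / 2 : ℝ) • (S.br V W + S.Jsec (S.br (S.Jsec V) W)) := rfl

/-- `(V, W) ↦ ½([V, W] - [JV, JW])`. -/
def bracket01 : S.TField →ₗ[ℝ] S.TField →ₗ[ℝ] S.TField :=
  LinearMap.mk₂ ℝ (fun V W => (1 / 2 : ℝ) • (S.br V W - S.br (S.Jsec V) (S.Jsec W)))
    (fun V V' W => by simp only [map_add, LinearMap.add_apply]; module)
    (fun c V W => by
      simp only [map_smul, LinearMap.smul_apply, S.smul_Jsec]; module)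
    (fun V W W' => by simp only [map_add]; module)
    (fun c V W => by simp only [map_smul, S.smul_Jsec]; module)

theorem bracket01_apply (V W : S.TField) :
    S.bracket01 V W = (1 / 2 : ℝ) • (S.br V W - S.br (S.Jsec V) (S.Jsec W)) := rfl

theorem bracket01_swap (V W : S.TField) : S.bracket01 V W = -S.bracket01 W V := by
  rw [bracket01_apply, bracket01_apply, S.br_swap V W, S.br_swap (S.Jsec V)]
  module

theorem br_Jsec_Jsec (V W : S.TField) : S.br (S.Jsec V) (S.Jsec W) =
    S.br V W + S.Jsec (S.br (S.Jsec V) W) + S.Jsec (S.br V (S.Jsec W)) := by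
  have h := S.nijenhuis V W
  rw [sub_sub, sub_sub, sub_eq_zero] at h
  rw [h]; abel

theorem dbarVec_Jsec_left (V W : S.TField) :
    S.dbarVec (S.Jsec V) W = -S.Jsec (S.dbarVec V W) := by
  simp only [dbarVec_apply, S.smul_Jsec, map_add, AlmostLeviFlat.Jsec_Jsec, map_neg,
    LinearMap.neg_apply]
  module

theorem dbarVec_Jsec_right (V W : S.TField) :
    S.dbarVec V (S.Jsec W) = S.Jsec (S.dbarVec V W) := by
  simp only [dbarVec_apply, S.smul_Jsec, map_add, AlmostLeviFlat.Jsec_Jsec, br_Jsec_Jsec]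
  module

theorem bracket01_Jsec_left (V W : S.TField) :
    S.bracket01 (S.Jsec V) W = S.Jsec (S.bracket01 V W) := by
  simp only [bracket01_apply, S.smul_Jsec, map_sub, map_add, AlmostLeviFlat.Jsec_Jsec, map_neg,
    LinearMap.neg_apply, br_Jsec_Jsec]
  module

theorem dbarVec_smul_left (f : SmoothFun E L) (V W : S.TField) :
    S.dbarVec (f • V) W = f • S.dbarVec V W := by
  simp only [dbarVec_apply, map_smul, S.br_smul_left, map_sub, AlmostLeviFlat.Jsec_Jsec]
  rw [smul_comm f]
  congr 1
  module

theorem dbarVec_smul_right (V : S.TField) (f : SmoothFun E L) (W : S.TField) :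
    S.dbarVec V (f • W) = f • S.dbarVec V W +
      (1 / 2 : ℝ) • (dirDeriv (S.incl V) f • W + dirDeriv (S.incl (S.Jsec V)) f • S.Jsec W) := by
  simp only [dbarVec_apply, map_smul, S.br_smul_right, map_add]
  rw [smul_comm f, ← smul_add]
  congr 1
  module

theorem bracket01_smul_left (f : SmoothFun E L) (V W : S.TField) :
    S.bracket01 (f • V) W = f • S.bracket01 V W -
      (1 / 2 : ℝ) • (dirDeriv (S.incl W) f • V - dirDeriv (S.incl (S.Jsec W)) f • S.Jsec V) := by
  have h : S.br (S.Jsec (f • V)) (S.Jsec W) =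
      f • S.br (S.Jsec V) (S.Jsec W) - dirDeriv (S.incl (S.Jsec W)) f • S.Jsec V := by
    rw [map_smul, S.br_smul_left]
  rw [bracket01_apply, bracket01_apply, h, S.br_smul_left, smul_comm f]
  refine Eq.trans ?_ (smul_sub (1 / 2 : ℝ) _ _)
  congr 1
  module

theorem koszul_dbar_smul (p : ℕ) {P : S.TField [⋀^Fin p]→ₗ[SmoothFun E L] S.TField}
    (hP : P ∈ S.zeroForm p) (v : Fin (p + 1) → S.TField) (i : Fin (p + 1))
    (a : SmoothFun E L) (w : S.TField) :
    koszul S.dbarVec S.bracket01 p (toReal P) (Function.update v i (a • w)) =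
      a • koszul S.dbarVec S.bracket01 p (toReal P) (Function.update v i w) := by
  cases p with
  | zero => exact koszul_smul_zero _ _ S.dbarVec_smul_left P v i a w
  | succ p =>
    refine koszul_smul_succ _ _ S.bracket01_swap S.dbarVec_smul_left P ?_ v i a w
    intro a u w x
    have key : ∀ (b c d e : SmoothFun E L) (y : S.TField),
        P (Matrix.vecCons (a • y - (1 / 2 : ℝ) • (d • w - e • S.Jsec w)) x) =
          a • P (Matrix.vecCons y x) - (1 / 2 : ℝ) •
            (d • P (Matrix.vecCons w x) + e • S.Jsec (P (Matrix.vecCons w x))) := by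
      intro b c d e y
      let Q : S.TField →ₗ[SmoothFun E L] S.TField :=
        { toFun := fun y => P (Matrix.vecCons y x)
          map_add' := fun y z => P.map_vecCons_add x y z
          map_smul' := fun c y => P.map_vecCons_smul x c y }
      have hQ : ∀ y, P (Matrix.vecCons y x) = Q y := fun _ => rfl
      have hJ : Q (S.Jsec w) = -S.Jsec (Q w) := S.zeroForm_cons hP w x
      have hs : ∀ (c : ℝ) y, Q (c • y) = c • Q y := fun c y =>
        (Q.restrictScalars ℝ).map_smul c y
      simp only [hQ, map_sub, map_smul, hs, hJ]
      module
    rw [S.bracket01_smul_left, key 0 0, S.dbarVec_smul_right]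
    abel

/-- The operator `∂̄ : Λ^{0,p}(ξ) ⊗ ξ → Λ^{0,p+1}(ξ) ⊗ ξ`,
`∂̄P(V₀, …, V_p) = ∑ᵢ (-1)ⁱ ∂̄(P(V₀, …, V̂ᵢ, …, V_p))(Vᵢ)
  + ∑_{i<j} (-1)^{i+j} P(½([Vᵢ, Vⱼ] - [JVᵢ, JVⱼ]), V₀, …, V̂ᵢ, …, V̂ⱼ, …, V_p)`
where `(∂̄W)(V) = ½([V, W] + J[JV, W])`. -/
def dbar (p : ℕ) : S.zeroForm p →ₗ[ℝ] S.zeroForm (p + 1) where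
  toFun P := ⟨ofReal (koszul S.dbarVec S.bracket01 p (toReal P.1)) (S.koszul_dbar_smul p P.2), by
    refine S.mem_zeroForm_of_cons fun w x => ?_
    obtain ⟨P, hP⟩ := P
    cases p with
    | zero =>
      rw [ofReal_apply, ofReal_apply, koszul_zero_cons, koszul_zero_cons, S.dbarVec_Jsec_left]
    | succ p =>
      refine koszul_cons_compat S.dbarVec S.bracket01 S.bracket01_swap (S.Jsec.restrictScalars ℝ)
        (-(S.Jsec.restrictScalars ℝ)) S.dbarVec_Jsec_left (toReal P) ?_
        (S.zeroForm_cons hP) w x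
      intro u w x
      simp only [toReal_apply, LinearMap.restrictScalars_apply, LinearMap.neg_apply, map_neg,
        S.bracket01_Jsec_left, S.dbarVec_Jsec_right, S.zeroForm_cons hP]
      abel⟩
  map_add' P Q := by
    have h : toReal (P + Q).1 = toReal P.1 + toReal Q.1 := rfl
    refine Subtype.ext (AlternatingMap.ext fun v => ?_)
    change koszul S.dbarVec S.bracket01 p (toReal (P + Q).1) v =
      koszul S.dbarVec S.bracket01 p (toReal P.1) v + koszul S.dbarVec S.bracket01 p (toReal Q.1) v
    rw [h, map_add, AlternatingMap.add_apply]
  map_smul' c P := by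
    have h : toReal (c • P).1 = c • toReal P.1 := rfl
    refine Subtype.ext (AlternatingMap.ext fun v => ?_)
    change koszul S.dbarVec S.bracket01 p (toReal (c • P).1) v =
      c • koszul S.dbarVec S.bracket01 p (toReal P.1) v
    rw [h, map_smul, AlternatingMap.smul_apply]

/-! #### The `(0,p)`-part of a form -/

/-- The summand `α(J^{ε₁}V₁, …, J^{ε_p}V_p) J^{ε₁ + ⋯ + ε_p}` of the `(0,p)`-part of `α`. -/
def zeroPartTerm {p : ℕ} (α : Form E L p) (ε : Fin p → Fin 2) :
    MultilinearMap (SmoothFun E L) (fun _ : Fin p => S.TField)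
      (Module.End (SmoothFun E L) S.TField) :=
  ((LinearMap.toSpanSingleton (SmoothFun E L) (Module.End (SmoothFun E L) S.TField)
      (S.Jsec ^ (∑ i, (ε i : ℕ)))).compMultilinearMap α.toMultilinearMap).compLinearMap
    (fun i => S.incl ∘ₗ (S.Jsec ^ (ε i : ℕ)))

theorem zeroPartTerm_apply {p : ℕ} (α : Form E L p) (ε : Fin p → Fin 2)
    (v : Fin p → S.TField) :
    S.zeroPartTerm α ε v =
      α (fun i => S.incl ((S.Jsec ^ (ε i : ℕ)) (v i))) • S.Jsec ^ (∑ i, (ε i : ℕ)) := rfl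

/-- The `(0,p)`-part `α^{0,p}` of the restriction of `α` to the leaves. The complex valued function
`α^{0,p}(V₁, …, V_p)` is the value of the `ℂ`-multilinear extension of `α` on the vectors
`½(Vᵢ + √-1 J Vᵢ)`, and a complex valued function `f + √-1 g` is regarded as the endomorphism
`f + g J` of `ξ`. Hence
`α^{0,p}(V₁, …, V_p) = 2^{-p} ∑_{ε ∈ {0,1}^p} α(J^{ε₁}V₁, …, J^{ε_p}V_p) J^{ε₁ + ⋯ + ε_p}`. -/
def zeroPart {p : ℕ} (α : Form E L p) :
    S.TField [⋀^Fin p]→ₗ[SmoothFun E L] Module.End (SmoothFun E L) S.TField where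
  toMultilinearMap := ((1 / 2 : ℝ) ^ p) • ∑ ε : Fin p → Fin 2, S.zeroPartTerm α ε
  map_eq_zero_of_eq' := by
    intro v i j hv hij
    have h : ∀ W : S.TField, ∑ ε : Fin p → Fin 2, S.zeroPartTerm α ε v W =
        -∑ ε : Fin p → Fin 2, S.zeroPartTerm α ε v W := by
      intro W
      rw [← Finset.sum_neg_distrib]
      refine Fintype.sum_equiv (Equiv.arrowCongr (Equiv.swap i j) (Equiv.refl _)) _ _ fun ε => ?_
      have h1 : (fun k => S.incl ((S.Jsec ^ ((ε (Equiv.swap i j k) : Fin 2) : ℕ)) (v k))) =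
          (fun k => S.incl ((S.Jsec ^ (ε k : ℕ)) (v k))) ∘ Equiv.swap i j := by
        ext1 k
        have : v (Equiv.swap i j k) = v k := by
          rw [Equiv.swap_apply_def]
          split_ifs with h1 h2
          · rw [h1, hv]
          · rw [h2, hv]
          · rfl
        simp only [Function.comp_apply, this]
      have h2 : ∑ k, ((ε (Equiv.swap i j k) : Fin 2) : ℕ) = ∑ k, (ε k : ℕ) :=
        Equiv.sum_comp (Equiv.swap i j) fun k => (ε k : ℕ)
      simp only [zeroPartTerm_apply, Equiv.arrowCongr_apply, Equiv.coe_refl, id_eq,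
        Function.comp_apply, Equiv.symm_swap, LinearMap.smul_apply]
      rw [h1, h2, α.map_swap _ hij, neg_smul, neg_neg]
    have h0 : ∀ W : S.TField, ∑ ε : Fin p → Fin 2, S.zeroPartTerm α ε v W = 0 := by
      intro W
      have h' : (2 : ℝ) • ∑ ε : Fin p → Fin 2, S.zeroPartTerm α ε v W = 0 := by
        rw [two_smul]; nth_rewrite 1 [h]; exact neg_add_cancel _
      exact (smul_eq_zero.mp h').resolve_left two_ne_zero
    change ((1 / 2 : ℝ) ^ p • ∑ ε : Fin p → Fin 2, S.zeroPartTerm α ε) v = 0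
    refine LinearMap.ext fun W => ?_
    rw [smul_apply, sum_apply, LinearMap.smul_apply, LinearMap.sum_apply, h0,
      smul_zero, LinearMap.zero_apply]

theorem zeroPart_apply {p : ℕ} (α : Form E L p) (v : Fin p → S.TField) :
    S.zeroPart α v = (1 / 2 : ℝ) ^ p • ∑ ε : Fin p → Fin 2,
      α (fun i => S.incl ((S.Jsec ^ (ε i : ℕ)) (v i))) • S.Jsec ^ (∑ i, (ε i : ℕ)) := by
  change ((1 / 2 : ℝ) ^ p • ∑ ε : Fin p → Fin 2, S.zeroPartTerm α ε) v = _
  rw [smul_apply, sum_apply]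
  rfl

end LeviFlatStructure

end LeviFlatStructures

/-! #### The product `α^{0,p} ∧ P` -/

section Wedge

variable {E L : Type*} [NormedAddCommGroup E] [NormedSpace ℝ E] [CompleteSpace E]
  [TopologicalSpace L] [ChartedSpace E L] [IsManifold 𝓘(ℝ, E) ∞ L]

namespace LeviFlatStructure

variable (S : LeviFlatStructure E L)

theorem zeroPart_apply_apply {p : ℕ} (α : Form E L p) (v : Fin p → S.TField)
    (W : S.TField) :
    S.zeroPart α v W = (1 / 2 : ℝ) ^ p • ∑ ε : Fin p → Fin 2,
      α (fun i => S.incl ((S.Jsec ^ (ε i : ℕ)) (v i))) • (S.Jsec ^ (∑ i, (ε i : ℕ))) W := by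
  rw [zeroPart_apply, LinearMap.smul_apply, LinearMap.sum_apply]
  rfl

theorem zeroPart_Jsec {p : ℕ} (α : Form E L p) (v : Fin p → S.TField) (W : S.TField) :
    S.zeroPart α v (S.Jsec W) = S.Jsec (S.zeroPart α v W) := by
  rw [zeroPart_apply_apply, zeroPart_apply_apply, S.smul_Jsec, map_sum]
  congr 1
  refine Finset.sum_congr rfl fun ε _ => ?_
  rw [map_smul]
  congr 1
  rw [← Module.End.mul_apply, ← Module.End.mul_apply, ← pow_succ, ← pow_succ']

theorem zeroPart_cons {p : ℕ} (α : Form E L (p + 1)) (w : S.TField) (x : Fin p → S.TField)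
    (W : S.TField) :
    S.zeroPart α (Matrix.vecCons (S.Jsec w) x) W =
      -S.Jsec (S.zeroPart α (Matrix.vecCons w x) W) := by
  rw [zeroPart_apply_apply, zeroPart_apply_apply, S.smul_Jsec, map_sum, ← smul_neg,
    ← Finset.sum_neg_distrib]
  congr 1
  rw [← (Fin.consEquiv fun _ => Fin 2).sum_comp, ← (Fin.consEquiv fun _ => Fin 2).sum_comp,
    Fintype.sum_prod_type, Fintype.sum_prod_type]
  simp only [Fin.sum_univ_two, Fin.consEquiv_apply]
  rw [add_comm]
  have hf : ∀ (a b : Fin 2) (y z : S.TField) (η : Fin p → Fin 2),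
      (S.Jsec ^ (a : ℕ)) y = (S.Jsec ^ (b : ℕ)) z →
      (fun i => S.incl ((S.Jsec ^ ((Fin.cons a η : Fin (p + 1) → Fin 2) i : ℕ))
        (Matrix.vecCons y x i))) =
      (fun i => S.incl ((S.Jsec ^ ((Fin.cons b η : Fin (p + 1) → Fin 2) i : ℕ))
        (Matrix.vecCons z x i))) := by
    intro a b y z η h
    ext1 i
    refine Fin.cases ?_ (fun i => ?_) i
    · simpa using congrArg S.incl h
    · simp
  have hneg : ∀ (η : Fin p → Fin 2),
      (α fun i => S.incl ((S.Jsec ^ ((Fin.cons 1 η : Fin (p + 1) → Fin 2) i : ℕ))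
        (Matrix.vecCons (S.Jsec w) x i))) =
      -α fun i => S.incl ((S.Jsec ^ ((Fin.cons 0 η : Fin (p + 1) → Fin 2) i : ℕ))
        (Matrix.vecCons w x i)) := by
    intro η
    have e : ∀ y : S.TField, (fun i => S.incl ((S.Jsec ^ ((Fin.cons 0 η : Fin (p + 1) → Fin 2) i : ℕ))
        (Matrix.vecCons y x i))) = Matrix.vecCons (S.incl y)
          (fun i => S.incl ((S.Jsec ^ (η i : ℕ)) (x i))) := by
      intro y
      ext1 i
      refine Fin.cases ?_ (fun i => ?_) i <;> simp
    rw [hf 1 0 (S.Jsec w) (-w) η (by simp), e, e]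
    have h : S.incl (-w) = (-1 : SmoothFun E L) • S.incl w := by
      simp
    rw [h, α.map_vecCons_smul]
    simp
  congr 1
  · refine Finset.sum_congr rfl fun η _ => ?_
    rw [hneg]
    simp [Fin.sum_univ_succ, pow_add]
  · refine Finset.sum_congr rfl fun η _ => ?_
    rw [hf 0 1 (S.Jsec w) w η (by simp)]
    simp [Fin.sum_univ_succ, pow_add]

theorem zeroPart_add {p : ℕ} (α β : Form E L p) (v : Fin p → S.TField) (W : S.TField) :
    S.zeroPart (α + β) v W = S.zeroPart α v W + S.zeroPart β v W := by
  simp only [zeroPart_apply_apply, AlternatingMap.add_apply, add_smul, Finset.sum_add_distrib,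
    smul_add]

theorem zeroPart_smul {p : ℕ} (c : ℝ) (α : Form E L p) (v : Fin p → S.TField)
    (W : S.TField) : S.zeroPart (c • α) v W = c • S.zeroPart α v W := by
  simp only [zeroPart_apply_apply, AlternatingMap.smul_apply, smul_assoc, Finset.smul_sum,
    smul_comm c]

/-- The map `u ↦ (v ↦ α^{0,p}(v)(P(u)))`, before alternation. -/
def preWedge (P : S.zeroForm 1) {p : ℕ} (α : Form E L p) :
    S.TField →ₗ[SmoothFun E L] S.TField [⋀^Fin p]→ₗ[SmoothFun E L] S.TField where
  toFun u := (LinearMap.applyₗ (P.1 ![u])).compAlternatingMap (S.zeroPart α)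
  map_add' u u' := by
    have h : P.1 ![u + u'] = P.1 ![u] + P.1 ![u'] := P.1.map_vecCons_add ![] u u'
    refine AlternatingMap.ext fun v => ?_
    simp [h]
  map_smul' f u := by
    have h : P.1 ![f • u] = f • P.1 ![u] := P.1.map_vecCons_smul ![] f u
    refine AlternatingMap.ext fun v => ?_
    simp [h]

theorem preWedge_apply (P : S.zeroForm 1) {p : ℕ} (α : Form E L p) (u : S.TField)
    (v : Fin p → S.TField) : S.preWedge P α u v = S.zeroPart α v (P.1 ![u]) := rfl

/-- The product `α^{0,p} ∧ P ∈ Λ^{0,p+1}(ξ) ⊗ ξ` for `P ∈ Λ^{0,1}(ξ) ⊗ ξ`,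
`(α^{0,p} ∧ P)(V₀, …, V_p) = (-1)^p ∑ᵢ (-1)ⁱ α^{0,p}(V₀, …, V̂ᵢ, …, V_p) P(Vᵢ)`,
see `wedgeZero_apply`. -/
def wedgeZero (P : S.zeroForm 1) (p : ℕ) : Form E L p →ₗ[ℝ] S.zeroForm (p + 1) where
  toFun α := ⟨((-1) ^ p : ℤ) • AlternatingMap.alternatizeUncurryFin (S.preWedge P α), by
    have hu : ∀ w, P.1 ![S.Jsec w] = -S.Jsec (P.1 ![w]) := fun w => S.zeroForm_cons P.2 w ![]
    refine S.mem_zeroForm_of_cons fun w x => ?_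
    rw [AlternatingMap.smul_apply, AlternatingMap.smul_apply, map_zsmul, ← smul_neg]
    congr 1
    cases p with
    | zero =>
      rw [alternatizeUncurryFin_zero_cons, alternatizeUncurryFin_zero_cons, preWedge_apply,
        preWedge_apply, hu, map_neg, zeroPart_Jsec]
    | succ p =>
      rw [alternatizeUncurryFin_cons, alternatizeUncurryFin_cons]
      simp only [preWedge_apply, hu, map_neg, zeroPart_Jsec, zeroPart_cons, map_sub, map_sum,
        map_zsmul, smul_neg, Finset.sum_neg_distrib]
      abel⟩
  map_add' α β := by
    refine Subtype.ext (AlternatingMap.ext fun v => ?_)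
    simp only [Submodule.coe_add, AlternatingMap.add_apply, AlternatingMap.smul_apply,
      AlternatingMap.alternatizeUncurryFin_apply, preWedge_apply, zeroPart_add, smul_add,
      Finset.sum_add_distrib]
  map_smul' c α := by
    refine Subtype.ext (AlternatingMap.ext fun v => ?_)
    simp only [Submodule.coe_smul, AlternatingMap.smul_apply, RingHom.id_apply,
      AlternatingMap.alternatizeUncurryFin_apply, preWedge_apply, zeroPart_smul, Finset.smul_sum,
      smul_comm c]

theorem wedgeZero_apply (P : S.zeroForm 1) {p : ℕ} (α : Form E L p)
    (v : Fin (p + 1) → S.TField) :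
    (S.wedgeZero P p α).1 v = ((-1) ^ p : ℤ) • ∑ i : Fin (p + 1), ((-1) ^ (i : ℕ) : ℤ) •
      S.zeroPart α (i.removeNth v) (P.1 ![v i]) := by
  change (((-1) ^ p : ℤ) • AlternatingMap.alternatizeUncurryFin (S.preWedge P α)) v = _
  rw [AlternatingMap.smul_apply, AlternatingMap.alternatizeUncurryFin_apply]
  rfl

end LeviFlatStructure

end Wedge

/-! ### The complex of a defining couple -/

section DefiningCouples

variable {E L : Type*} [NormedAddCommGroup E] [NormedSpace ℝ E] [CompleteSpace E]
  [TopologicalSpace L] [ChartedSpace E L] [IsManifold 𝓘(ℝ, E) ∞ L]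

/-- A defining couple `(γ, X)` for `ξ`: a `1`-form `γ` and a vector field `X` with `ξ = ker γ` and
`γ(X) = 1`. -/
structure DefiningCouple (S : LeviFlatStructure E L) where
  /-- the `1`-form -/
  γ : Form E L 1
  /-- the transverse vector field -/
  X : VField E L
  ker_eq : ∀ (V : VField E L) (x : L), γ ![V] x = 0 ↔ V x ∈ S.ξ x
  γ_X : γ ![X] = 1

namespace DefiningCouple

open AlmostLeviFlat

variable {S : LeviFlatStructure E L} (c : DefiningCouple S)

/-- The projection `W ↦ W - γ(W) X` onto the vector fields tangent to `ξ`. -/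
def proj : VField E L →ₗ[SmoothFun E L] S.TField where
  toFun W := TField.mk (W - c.γ ![W] • c.X) fun x => (c.ker_eq _ x).1 (by
    have h : c.γ ![W - c.γ ![W] • c.X] = 0 := by
      have h1 : c.γ ![W - c.γ ![W] • c.X] = c.γ ![W] + c.γ ![(-c.γ ![W]) • c.X] := by
        rw [← c.γ.map_vecCons_add, neg_smul, sub_eq_add_neg]
      rw [h1, c.γ.map_vecCons_smul, c.γ_X]
      simp
    rw [h]; rfl)
  map_add' V W := TField.ext (by
    have h : c.γ ![V + W] = c.γ ![V] + c.γ ![W] := c.γ.map_vecCons_add ![] V W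
    rw [map_add, incl_mk, incl_mk, incl_mk, h]; module)
  map_smul' f V := TField.ext (by
    have h : c.γ ![f • V] = f • c.γ ![V] := c.γ.map_vecCons_smul ![] f V
    rw [map_smul, incl_mk, incl_mk, h, RingHom.id_apply, smul_sub, smul_assoc])

theorem incl_proj (W : VField E L) : S.incl (c.proj W) = W - c.γ ![W] • c.X := rfl

theorem proj_incl (V : S.TField) : c.proj (S.incl V) = V := by
  have h : c.γ ![S.incl V] = 0 := by ext x; exact (c.ker_eq (S.incl V) x).2 (S.incl_mem V x)
  refine TField.ext ?_
  rw [incl_proj, h, zero_smul, sub_zero]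

/-- `T_Y(V) = [V, Y] - γ([V, Y]) X` for a vector field `Y` and `V` tangent to `ξ`. -/
def T (Y : VField E L) : S.TField →ₗ[ℝ] S.TField where
  toFun V := c.proj (bracket (S.incl V) Y)
  map_add' V W := by simp
  map_smul' a V := by
    simp only [S.incl_smul, map_smul, LinearMap.smul_apply, RingHom.id_apply]
    exact (c.proj.restrictScalars ℝ).map_smul a _

theorem T_apply (Y : VField E L) (V : S.TField) :
    c.T Y V = c.proj (bracket (S.incl V) Y) := rfl

theorem T_smul (Y : VField E L) (f : SmoothFun E L) (V : S.TField) :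
    c.T Y (f • V) = f • c.T Y V - dirDeriv Y f • V := by
  rw [T_apply, map_smul, bracket_smul_left, map_sub, map_smul, map_smul, proj_incl, T_apply]

/-- `H_Y(V) = ½(T_Y(V) + J T_Y(JV))`, as a linear map. -/
def HLin (Y : VField E L) : S.TField →ₗ[SmoothFun E L] S.TField where
  toFun V := (1 / 2 : ℝ) • (c.T Y V + S.Jsec (c.T Y (S.Jsec V)))
  map_add' V W := by
    rw [← smul_add]
    congr 1
    simp only [map_add]
    abel
  map_smul' f V := by
    rw [RingHom.id_apply, smul_comm f]
    congr 1
    simp only [map_smul, T_smul, map_sub, AlmostLeviFlat.Jsec_Jsec]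
    module

theorem HLin_apply (Y : VField E L) (V : S.TField) :
    c.HLin Y V = (1 / 2 : ℝ) • (c.T Y V + S.Jsec (c.T Y (S.Jsec V))) := rfl

/-- The form `H_Y ∈ Λ^{0,1}(ξ) ⊗ ξ`, `H_Y(V) = ½(T_Y(V) + J T_Y(JV))`. -/
def H : VField E L →ₗ[ℝ] S.zeroForm 1 where
  toFun Y := ⟨AlternatingMap.ofSubsingleton (SmoothFun E L) S.TField S.TField (0 : Fin 1)
      (c.HLin Y), by
    refine S.mem_zeroForm_of_cons fun w x => ?_
    change c.HLin Y (S.Jsec w) = -S.Jsec (c.HLin Y w)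
    simp only [HLin_apply, AlmostLeviFlat.Jsec_Jsec, map_neg, S.smul_Jsec, map_add]
    module⟩
  map_add' Y Z := by
    refine Subtype.ext (AlternatingMap.ext fun v => ?_)
    change c.HLin (Y + Z) (v 0) = c.HLin Y (v 0) + c.HLin Z (v 0)
    simp only [HLin_apply, T_apply, map_add]
    module
  map_smul' a Y := by
    refine Subtype.ext (AlternatingMap.ext fun v => ?_)
    change c.HLin (a • Y) (v 0) = a • c.HLin Y (v 0)
    have h : ∀ W, c.proj (a • W) = a • c.proj W := (c.proj.restrictScalars ℝ).map_smul a
    simp only [HLin_apply, T_apply, map_smul, h, S.smul_Jsec]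
    module

theorem H_apply (Y : VField E L) (V : S.TField) :
    (c.H Y).1 ![V] = (1 / 2 : ℝ) • (c.T Y V + S.Jsec (c.T Y (S.Jsec V))) := rfl

/-- The space `𝒵^p(L)` of `p`-forms `α` with `ι_X α = 0`. -/
abbrev Z (p : ℕ) : Submodule ℝ (Form E L p) := horizontal c.X p

/-- The operator `δ : 𝒵^p(L) → 𝒵^{p+1}(L)`, `δα = dα + {γ, α}`. -/
def delta (p : ℕ) : c.Z p →ₗ[ℝ] c.Z (p + 1) :=
  (deltaForm c.γ c.X p).restrict (deltaForm_mem c.γ c.X c.γ_X p)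

/-- `𝔷^p = 𝒵^p(L) ⊕ Λ^{0,p}(ξ) ⊗ ξ`. -/
def Cochain (p : ℕ) : Type _ := c.Z p × S.zeroForm p

instance (p : ℕ) : AddCommGroup (c.Cochain p) := inferInstanceAs (AddCommGroup (c.Z p × S.zeroForm p))

instance (p : ℕ) : Module ℝ (c.Cochain p) := inferInstanceAs (Module ℝ (c.Z p × S.zeroForm p))

/-- The component of a cochain in `𝒵^p(L)`. -/
def formPart (p : ℕ) : c.Cochain p →ₗ[ℝ] c.Z p := LinearMap.fst ℝ (c.Z p) (S.zeroForm p)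

/-- The component of a cochain in `Λ^{0,p}(ξ) ⊗ ξ`. -/
def vecPart (p : ℕ) : c.Cochain p →ₗ[ℝ] S.zeroForm p := LinearMap.snd ℝ (c.Z p) (S.zeroForm p)

variable {c} in
/-- The cochain `(α, P)`. -/
def Cochain.mk {p : ℕ} (α : c.Z p) (P : S.zeroForm p) : c.Cochain p := (α, P)

variable {c} in
theorem Cochain.ext {p : ℕ} {a b : c.Cochain p} (h1 : c.formPart p a = c.formPart p b)
    (h2 : c.vecPart p a = c.vecPart p b) : a = b := Prod.ext h1 h2

@[simp] theorem formPart_mk {p : ℕ} (α : c.Z p) (P : S.zeroForm p) :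
    c.formPart p (Cochain.mk α P) = α := rfl

@[simp] theorem vecPart_mk {p : ℕ} (α : c.Z p) (P : S.zeroForm p) :
    c.vecPart p (Cochain.mk α P) = P := rfl

/-- The map `𝒵^p(L) → Λ^{0,p+1}(ξ) ⊗ ξ`, `α ↦ α^{0,p} ∧ H`, where `H = H_X`. -/
def wedgeH (p : ℕ) : c.Z p →ₗ[ℝ] S.zeroForm (p + 1) :=
  S.wedgeZero (c.H c.X) p ∘ₗ (c.Z p).subtype

/-- The differential `𝔡^p(α, P) = (δα, ∂̄P + (-1)^{p+1} α^{0,p} ∧ H)`. -/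
def diff (p : ℕ) : c.Cochain p →ₗ[ℝ] c.Cochain (p + 1) where
  toFun a := Cochain.mk (c.delta p (c.formPart p a))
    (S.dbar p (c.vecPart p a) + (-1 : ℝ) ^ (p + 1) • c.wedgeH p (c.formPart p a))
  map_add' a b := Cochain.ext (by simp) (by simp; abel)
  map_smul' t a := Cochain.ext (by simp) (by simp [smul_comm t])

/-- The cohomology `H¹(𝔷, 𝔡)`: the kernel of `𝔡¹` modulo the image of `𝔡⁰`. -/
abbrev H1 : Type _ :=
  LinearMap.ker (c.diff 1) ⧸ (LinearMap.range (c.diff 0)).submoduleOf (LinearMap.ker (c.diff 1))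

/-- The space `𝒜` of the pairs `(β, P) ∈ 𝔷¹` with `δβ = 0` and `∂̄P = -β^{0,1} ∧ H`. -/
def infDef : Submodule ℝ (c.Cochain 1) where
  carrier := {a | c.delta 1 (c.formPart 1 a) = 0 ∧
    S.dbar 1 (c.vecPart 1 a) = -c.wedgeH 1 (c.formPart 1 a)}
  add_mem' := by
    rintro a b ⟨h1, h2⟩ ⟨h3, h4⟩
    refine ⟨?_, ?_⟩
    · rw [map_add, map_add, h1, h3, add_zero]
    · rw [map_add, map_add, h2, h4, map_add, map_add, neg_add]
  zero_mem' := by simp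
  smul_mem' := by
    rintro t a ⟨h1, h2⟩
    refine ⟨?_, ?_⟩
    · rw [map_smul, map_smul, h1, smul_zero]
    · rw [map_smul, map_smul, h2, map_smul, map_smul, smul_neg]

theorem mem_infDef (a : c.Cochain 1) : a ∈ c.infDef ↔ c.delta 1 (c.formPart 1 a) = 0 ∧
    S.dbar 1 (c.vecPart 1 a) = -c.wedgeH 1 (c.formPart 1 a) := Iff.rfl

/-- The function `γ(Y) = ι_Y γ`, as an element of `𝒵⁰(L) = C^∞(L)`. -/
def gammaFun : VField E L →ₗ[ℝ] c.Z 0 where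
  toFun Y := ⟨interior Y c.γ, Submodule.mem_top⟩
  map_add' Y Z := Subtype.ext (AlternatingMap.ext fun v => c.γ.map_vecCons_add v Y Z)
  map_smul' t Y := Subtype.ext (AlternatingMap.ext fun v => (toReal c.γ).map_vecCons_smul v t Y)

/-- The infinitesimal action `Y ↦ (δ(ι_Y γ), -H_Y)` of vector fields. -/
def infAction : VField E L →ₗ[ℝ] c.Cochain 1 where
  toFun Y := Cochain.mk (c.delta 0 (c.gammaFun Y)) (-c.H Y)
  map_add' Y Z := Cochain.ext (by simp) (by simp; abel)
  map_smul' t Y := Cochain.ext (by simp) (by simp)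

/-- The relation `(β, P) ∼ (β', P')`: there is a vector field `Y` on `L` with
`β - β' = δ(ι_Y γ)` and `P - P' = -H_Y`. -/
def GaugeEquiv (a a' : c.Cochain 1) : Prop :=
  ∃ Y : VField E L, c.formPart 1 a - c.formPart 1 a' = c.delta 0 (c.gammaFun Y) ∧
    c.vecPart 1 a - c.vecPart 1 a' = -c.H Y

theorem gaugeEquiv_iff (a a' : c.Cochain 1) :
    c.GaugeEquiv a a' ↔ a - a' ∈ LinearMap.range c.infAction := by
  constructor
  · rintro ⟨Y, h1, h2⟩
    exact ⟨Y, Cochain.ext (by rw [map_sub, h1]; rfl) (by rw [map_sub, h2]; rfl)⟩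
  · rintro ⟨Y, h⟩
    exact ⟨Y, by rw [← map_sub (c.formPart 1), ← h]; rfl, by rw [← map_sub (c.vecPart 1), ← h]; rfl⟩

/-- The quotient `𝒜/∼` by the relation `GaugeEquiv`, see `infModuli_mk_eq_mk`. -/
abbrev InfModuli : Type _ :=
  c.infDef ⧸ (LinearMap.range c.infAction).submoduleOf c.infDef

theorem infModuli_mk_eq_mk (a a' : c.infDef) :
    (Submodule.Quotient.mk a : c.InfModuli) = Submodule.Quotient.mk a' ↔
      c.GaugeEquiv a.1 a'.1 := by
  rw [Submodule.Quotient.eq, gaugeEquiv_iff]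
  rfl

end DefiningCouple

end DefiningCouples

end LeviFlat

end

/-!
A vector field on `L` is uniquely `Y = W + fX` with `f = γ(Y)` and `W` tangent to `ξ`. The expression
`H_Y` is linear over functions in the `X`-direction, and `H_W = ∂̄W` for `W` tangent to `ξ`, so
`H_Y = ∂̄W + fH` and the infinitesimal action `(δf, -H_Y)` of `Y` is exactly `𝔡⁰(f, -W)`
(`infAction_eq_diff`). Hence the subspace of infinitesimal actions is the image of `𝔡⁰`
(`range_infAction`). The equations defining `𝒜` say `𝔡¹ = 0` (`ker_diff_one`), so the two quotients
have the same numerator and the same denominator.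

The remaining point is `𝔡¹ ∘ 𝔡⁰ = 0` (`diff_diff_zero`), which amounts to

* `δ² = 0` on functions (`delta_delta_zero`),
* `∂̄² = 0` on vector fields tangent to `ξ` (`dbar_dbar_zero`),
* `∂̄(fH) = (δf)^{0,1} ∧ H` (`dbar_wedgeH_zero`).

All three come from the Jacobi identity. For `V` tangent to `ξ` write `[V, X] = T(V) + θ(V) X`, where
`T = T_X` and `θ` is the restriction of `ℒ_X γ` to the leaves. The two components of the Jacobi
identity for `V`, `W`, `X` are `dθ = 0` along the leaves (`theta_br`), which gives `δ² = 0`, and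
`T[V, W] = [V, TW] + [TV, W] + θ(W) TV - θ(V) TW` (`T_X_br`), which gives `∂̄H = θ^{0,1} ∧ H`
(`dbarVec_HLin_X_sub`). In `∂̄² = 0` and `∂̄H = θ^{0,1} ∧ H` the vanishing of the Nijenhuis tensor
enters through the complex linearity of `∂̄` and of `½([V, W] - [JV, JW])`.
-/

noncomputable section

namespace LeviFlat

open AlternatingMap AlmostLeviFlat

/-! ### Forms of low degree -/

section LowDegree

variable {E L : Type*} [NormedAddCommGroup E] [NormedSpace ℝ E]
  [TopologicalSpace L] [ChartedSpace E L] [IsManifold 𝓘(ℝ, E) ∞ L]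

theorem wedgeOne_one_apply (θ α : Form E L 1) (V W : VField E L) :
    wedgeOne θ α ![V, W] = θ ![V] * α ![W] - θ ![W] * α ![V] := by
  have h0 : Fin.removeNth (0 : Fin 2) ![V, W] = ![W] := by
    ext1 i; fin_cases i; rfl
  have h1 : Fin.removeNth (1 : Fin 2) ![V, W] = ![V] := by
    ext1 i; fin_cases i; rfl
  rw [wedgeOne_apply, Fin.sum_univ_two, h0, h1]
  simp [sub_eq_add_neg]

theorem wedgeOne_zero_apply (θ : Form E L 1) (f : Form E L 0) (V : VField E L) :
    wedgeOne θ f ![V] = θ ![V] * f ![] := by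
  rw [wedgeOne_apply, Fin.sum_univ_one, Subsingleton.elim (Fin.removeNth (0 : Fin 1) ![V]) ![]]
  simp

variable [CompleteSpace E]

theorem extD_zero_apply (f : Form E L 0) (V : VField E L) :
    extD 0 f ![V] = dirDeriv V (f ![]) := koszul_zero_cons dirDeriv bracket (toReal f) V ![]

theorem extD_one_apply (α : Form E L 1) (V W : VField E L) :
    extD 1 α ![V, W] = dirDeriv V (α ![W]) - dirDeriv W (α ![V]) - α ![bracket V W] := by
  change koszul dirDeriv bracket 1 (toReal α) (Matrix.vecCons V ![W]) = _
  rw [koszul_cons dirDeriv bracket bracket_swap, koszul_zero_cons]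
  have h : ∀ j : Fin 1, j.removeNth ![W] = ![] := fun _ => Subsingleton.elim _ _
  simp [h]
  ring

end LowDegree

/-! ### The Jacobi identity and its consequences for a defining couple -/

section Jacobi

variable {E L : Type*} [NormedAddCommGroup E] [NormedSpace ℝ E] [CompleteSpace E]
  [TopologicalSpace L] [ChartedSpace E L] [IsManifold 𝓘(ℝ, E) ∞ L]

/-- The Jacobi identity. -/
theorem bracket_bracket (U V W : VField E L) :
    bracket U (bracket V W) = bracket (bracket U V) W + bracket V (bracket U W) := by
  have : IsManifold 𝓘(ℝ, E) (minSmoothness ℝ 3) L := by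
    rw [minSmoothness_of_isRCLikeNormedField]
    exact IsManifold.of_le (n := ∞) ENat.LEInfty.out
  have h2 : minSmoothness ℝ 2 ≤ (∞ : WithTop ℕ∞) := by
    rw [minSmoothness_of_isRCLikeNormedField]
    exact ENat.LEInfty.out
  ext x
  exact VectorField.leibniz_identity_mlieBracket_apply (U.contMDiff.of_le h2 x)
    (V.contMDiff.of_le h2 x) (W.contMDiff.of_le h2 x)

theorem AlmostLeviFlat.br_br (S : AlmostLeviFlat E L) (U V W : S.TField) :
    S.br (S.br U V) W = S.br U (S.br V W) - S.br V (S.br U W) :=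
  TField.ext (by
    rw [map_sub]; simp only [incl_br]; rw [bracket_bracket (S.incl U)]; abel)

namespace DefiningCouple

variable {S : LeviFlatStructure E L} (c : DefiningCouple S)

/-- The `1`-form `γ`, as a linear functional on vector fields. -/
def gammaLin : VField E L →ₗ[SmoothFun E L] SmoothFun E L where
  toFun V := c.γ ![V]
  map_add' V W := c.γ.map_vecCons_add ![] V W
  map_smul' f V := c.γ.map_vecCons_smul ![] f V

theorem gammaLin_apply (V : VField E L) : c.gammaLin V = c.γ ![V] := rfl

theorem gammaLin_X : c.gammaLin c.X = 1 := c.γ_X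

theorem gammaLin_incl (V : S.TField) : c.gammaLin (S.incl V) = 0 := by
  ext x; exact (c.ker_eq (S.incl V) x).2 (S.incl_mem V x)

theorem proj_X : c.proj c.X = 0 :=
  TField.ext (by rw [incl_proj, c.γ_X, one_smul, sub_self, _root_.map_zero])

theorem eq_incl_proj_add (W : VField E L) : W = S.incl (c.proj W) + c.gammaLin W • c.X := by
  rw [incl_proj, gammaLin_apply, sub_add_cancel]

/-- The function `θ(V) = γ([V, X])` for `V` tangent to `ξ`. The `1`-form `ℒ_X γ` restricts to `θ`
on the leaves, see `lieD_gamma_incl`. -/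
def theta : S.TField →ₗ[ℝ] SmoothFun E L where
  toFun V := c.gammaLin (bracket (S.incl V) c.X)
  map_add' V W := by simp
  map_smul' t V := by
    rw [S.incl_smul, map_smul, LinearMap.smul_apply]
    exact (c.gammaLin.restrictScalars ℝ).map_smul t _

theorem theta_apply (V : S.TField) : c.theta V = c.gammaLin (bracket (S.incl V) c.X) := rfl

theorem bracket_incl_X (V : S.TField) :
    bracket (S.incl V) c.X = S.incl (c.T c.X V) + c.theta V • c.X :=
  c.eq_incl_proj_add _

theorem lieD_gamma_incl (V : S.TField) : lieD c.X 1 c.γ ![S.incl V] = c.theta V := by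
  change extD 1 c.γ ![c.X, S.incl V] + extD 0 (interior c.X c.γ) ![S.incl V] = _
  have h : interior c.X c.γ ![] = 1 := c.γ_X
  rw [extD_one_apply, extD_zero_apply, h, ← gammaLin_apply, ← gammaLin_apply, ← gammaLin_apply,
    gammaLin_incl, gammaLin_X, bracket_swap, theta_apply]
  simp

/-- The bracket acts on functions as the commutator of derivations. The Jacobi identity for
`V`, `W` and `fX` gives this multiplied by `X`, and `γ(X) = 1` allows to cancel `X`. -/
theorem dirDeriv_bracket (c : DefiningCouple S) (V W : VField E L) (f : SmoothFun E L) :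
    dirDeriv (bracket V W) f = dirDeriv V (dirDeriv W f) - dirDeriv W (dirDeriv V f) := by
  have h := bracket_bracket V W (f • c.X)
  simp only [bracket_smul_right, map_add] at h
  rw [bracket_bracket V W c.X] at h
  have h' := congrArg c.gammaLin h
  simp only [map_add, map_smul, gammaLin_X, smul_eq_mul] at h'
  linear_combination -h'

/-- The Jacobi identity for `V`, `W`, `X`, split into its components along `ξ` and `X`. -/
theorem bracket_br_X (V W : S.TField) : bracket (S.incl (S.br V W)) c.X =
    S.incl (S.br V (c.T c.X W) - S.br W (c.T c.X V) + c.theta W • c.T c.X V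
      - c.theta V • c.T c.X W) +
    (dirDeriv (S.incl V) (c.theta W) - dirDeriv (S.incl W) (c.theta V)) • c.X := by
  have h := bracket_bracket (S.incl V) (S.incl W) c.X
  rw [← S.incl_br, ← sub_eq_iff_eq_add] at h
  rw [← h]
  simp only [bracket_incl_X, map_add, map_sub, bracket_smul_right, map_smul, incl_br]
  module

/-- `dθ = 0` along the leaves. -/
theorem theta_br (V W : S.TField) : c.theta (S.br V W) =
    dirDeriv (S.incl V) (c.theta W) - dirDeriv (S.incl W) (c.theta V) := by
  rw [theta_apply, bracket_br_X, map_add, gammaLin_incl, map_smul, gammaLin_X]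
  simp

/-- `T_X` is a derivation of the bracket up to terms in `θ`. -/
theorem T_X_br (V W : S.TField) : c.T c.X (S.br V W) =
    S.br V (c.T c.X W) - S.br W (c.T c.X V) + c.theta W • c.T c.X V
      - c.theta V • c.T c.X W := by
  rw [T_apply, bracket_br_X, map_add, proj_incl, map_smul, proj_X]
  simp

end DefiningCouple

end Jacobi

/-! ### The operator `δ` in degrees `0` and `1` -/

section Delta

variable {E L : Type*} [NormedAddCommGroup E] [NormedSpace ℝ E] [CompleteSpace E]
  [TopologicalSpace L] [ChartedSpace E L] [IsManifold 𝓘(ℝ, E) ∞ L]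

namespace DefiningCouple

variable {S : LeviFlatStructure E L} (c : DefiningCouple S)

theorem delta_zero_incl (f : c.Z 0) (V : S.TField) : (c.delta 0 f).1 ![S.incl V] =
    dirDeriv (S.incl V) (f.1 ![]) + c.theta V * f.1 ![] := by
  change extD 0 f.1 ![S.incl V] + (wedgeOne (lieD c.X 1 c.γ) f.1 ![S.incl V] -
    wedgeOne c.γ (lieD c.X 0 f.1) ![S.incl V]) = _
  rw [extD_zero_apply, wedgeOne_zero_apply, wedgeOne_zero_apply, lieD_gamma_incl,
    ← gammaLin_apply, gammaLin_incl]
  simp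

theorem delta_one_incl (β : c.Z 1) (V W : S.TField) :
    (c.delta 1 β).1 ![S.incl V, S.incl W] =
      dirDeriv (S.incl V) (β.1 ![S.incl W]) - dirDeriv (S.incl W) (β.1 ![S.incl V])
      - β.1 ![S.incl (S.br V W)]
      + (c.theta V * β.1 ![S.incl W] - c.theta W * β.1 ![S.incl V]) := by
  change extD 1 β.1 ![S.incl V, S.incl W] +
    (wedgeOne (lieD c.X 1 c.γ) β.1 ![S.incl V, S.incl W] -
    wedgeOne c.γ (lieD c.X 1 β.1) ![S.incl V, S.incl W]) = _
  rw [extD_one_apply, wedgeOne_one_apply, wedgeOne_one_apply, lieD_gamma_incl, lieD_gamma_incl,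
    ← gammaLin_apply, ← gammaLin_apply, gammaLin_incl, gammaLin_incl, incl_br]
  simp

/-- A horizontal `2`-form is determined by its restriction to the leaves. -/
theorem horizontal_two_eq_zero {α : Form E L 2} (hα : α ∈ c.Z 2)
    (h : ∀ V W : S.TField, α ![S.incl V, S.incl W] = 0) : α = 0 := by
  have hX : ∀ W, α ![c.X, W] = 0 := fun W => congrArg (fun β : Form E L 1 => β ![W]) hα
  have hX' : ∀ W, α ![W, c.X] = 0 := fun W => by
    have := map_vecCons_vecCons_swap (toReal α) W c.X ![]
    simp only [toReal_apply] at this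
    rw [this, hX, neg_zero]
  have hl : ∀ (f : SmoothFun E L) (a b z : VField E L),
      α ![a + f • b, z] = α ![a, z] + f * α ![b, z] := fun f a b z => by
    rw [α.map_vecCons_add, α.map_vecCons_smul, smul_eq_mul]
  have hl' : ∀ (f : SmoothFun E L) (a b z : VField E L),
      α ![z, a + f • b] = α ![z, a] + f * α ![z, b] := fun f a b z => by
    have h1 : ∀ y, α ![z, y] = α.curryLeft z ![y] := fun _ => rfl
    rw [h1, (α.curryLeft z).map_vecCons_add, (α.curryLeft z).map_vecCons_smul, smul_eq_mul]
    rfl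
  ext1 v
  have hv : v = ![v 0, v 1] := by ext1 i; fin_cases i <;> rfl
  rw [hv, c.eq_incl_proj_add (v 0), c.eq_incl_proj_add (v 1), hl, hX, hl', hX', h]
  simp

theorem delta_delta_zero (f : c.Z 0) : c.delta 1 (c.delta 0 f) = 0 := by
  refine Subtype.ext (c.horizontal_two_eq_zero (c.delta 1 (c.delta 0 f)).2 fun V W => ?_)
  rw [delta_one_incl, delta_zero_incl, delta_zero_incl, delta_zero_incl]
  simp only [theta_br, incl_br, c.dirDeriv_bracket, map_add, dirDeriv_mul]
  ring

end DefiningCouple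

end Delta

/-! ### The operators `∂̄` and `α ↦ α^{0,p} ∧ P` in degrees `0` and `1` -/

section Dbar

variable {E L : Type*} [NormedAddCommGroup E] [NormedSpace ℝ E] [CompleteSpace E]
  [TopologicalSpace L] [ChartedSpace E L] [IsManifold 𝓘(ℝ, E) ∞ L]

namespace LeviFlatStructure

variable (S : LeviFlatStructure E L)

theorem dbar_zero_apply (P : S.zeroForm 0) (V : S.TField) :
    (S.dbar 0 P).1 ![V] = S.dbarVec V (P.1 ![]) :=
  koszul_zero_cons S.dbarVec S.bracket01 (toReal P.1) V ![]

theorem dbar_one_apply (P : S.zeroForm 1) (V W : S.TField) :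
    (S.dbar 1 P).1 ![V, W] =
      S.dbarVec V (P.1 ![W]) - S.dbarVec W (P.1 ![V]) - P.1 ![S.bracket01 V W] := by
  change koszul S.dbarVec S.bracket01 1 (toReal P.1) (Matrix.vecCons V ![W]) = _
  rw [koszul_cons S.dbarVec S.bracket01 S.bracket01_swap, koszul_zero_cons]
  have h : ∀ j : Fin 1, j.removeNth ![W] = ![] := fun _ => Subsingleton.elim _ _
  simp [h]
  abel

/-- `½([V, W] - [JV, JW])` is complex linear in `V`, by the vanishing of the Nijenhuis tensor. -/
theorem Jsec_bracket01 (V W : S.TField) : S.Jsec (S.bracket01 V W) =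
    (1 / 2 : ℝ) • (S.br (S.Jsec V) W + S.br V (S.Jsec W)) := by
  rw [← bracket01_Jsec_left, bracket01_apply, AlmostLeviFlat.Jsec_Jsec, map_neg,
    LinearMap.neg_apply, sub_neg_eq_add]

theorem dbarVec_dbarVec (V W U : S.TField) : S.dbarVec V (S.dbarVec W U) =
    (1 / 4 : ℝ) • (S.br V (S.br W U) - S.br (S.Jsec V) (S.br (S.Jsec W) U)
      + S.Jsec (S.br (S.Jsec V) (S.br W U) + S.br V (S.br (S.Jsec W) U))) := by
  rw [S.dbarVec_apply W U, map_smul, map_add, dbarVec_Jsec_right]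
  simp only [dbarVec_apply, S.smul_Jsec, map_add, AlmostLeviFlat.Jsec_Jsec]
  module

/-- Flatness of `∂̄` acting on vector fields, i.e. `∂̄² = 0` in degree `0`. -/
theorem dbarVec_bracket01 (V W U : S.TField) : S.dbarVec (S.bracket01 V W) U =
    S.dbarVec V (S.dbarVec W U) - S.dbarVec W (S.dbarVec V U) := by
  rw [dbarVec_apply, Jsec_bracket01, bracket01_apply, dbarVec_dbarVec, dbarVec_dbarVec]
  simp only [map_smul, LinearMap.smul_apply, map_add, map_sub, LinearMap.add_apply,
    LinearMap.sub_apply, S.smul_Jsec, AlmostLeviFlat.br_br]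
  module

theorem dbar_dbar_zero (P : S.zeroForm 0) : S.dbar 1 (S.dbar 0 P) = 0 := by
  refine Subtype.ext (AlternatingMap.ext fun v => ?_)
  have hv : v = ![v 0, v 1] := by ext1 i; fin_cases i <;> rfl
  rw [hv, dbar_one_apply]
  simp only [dbar_zero_apply, dbarVec_bracket01]
  simp

theorem zeroPart_zero_apply (f : Form E L 0) (v : Fin 0 → S.TField) (W : S.TField) :
    S.zeroPart f v W = f ![] • W := by
  rw [zeroPart_apply_apply]
  simp [Subsingleton.elim _ (![] : Fin 0 → VField E L)]

theorem zeroPart_one_apply (β : Form E L 1) (V W : S.TField) :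
    S.zeroPart β ![V] W =
      (1 / 2 : ℝ) • (β ![S.incl V] • W + β ![S.incl (S.Jsec V)] • S.Jsec W) := by
  have h : ∀ e : Fin 1 → Fin 2, (fun i => S.incl ((S.Jsec ^ (e i : ℕ)) (![V] i))) =
      ![S.incl ((S.Jsec ^ (e 0 : ℕ)) V)] := fun e => by ext1 i; fin_cases i; rfl
  rw [zeroPart_apply_apply]
  simp only [h]
  rw [← (Equiv.funUnique (Fin 1) (Fin 2)).symm.sum_comp, Fin.sum_univ_two]
  simp

theorem wedgeZero_zero_apply (P : S.zeroForm 1) (f : Form E L 0) (V : S.TField) :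
    (S.wedgeZero P 0 f).1 ![V] = f ![] • P.1 ![V] := by
  rw [wedgeZero_apply, Fin.sum_univ_one, zeroPart_zero_apply]
  simp

theorem wedgeZero_one_apply (P : S.zeroForm 1) (β : Form E L 1) (V W : S.TField) :
    (S.wedgeZero P 1 β).1 ![V, W] =
      S.zeroPart β ![V] (P.1 ![W]) - S.zeroPart β ![W] (P.1 ![V]) := by
  have h0 : Fin.removeNth (0 : Fin 2) ![V, W] = ![W] := by
    ext1 i; fin_cases i; rfl
  have h1 : Fin.removeNth (1 : Fin 2) ![V, W] = ![V] := by
    ext1 i; fin_cases i; rfl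
  rw [wedgeZero_apply, Fin.sum_univ_two, h0, h1]
  simp [sub_eq_add_neg, add_comm]

end LeviFlatStructure

end Dbar

/-! ### The identity `𝔡¹ ∘ 𝔡⁰ = 0` -/

section DiffSquared

variable {E L : Type*} [NormedAddCommGroup E] [NormedSpace ℝ E] [CompleteSpace E]
  [TopologicalSpace L] [ChartedSpace E L] [IsManifold 𝓘(ℝ, E) ∞ L]

namespace DefiningCouple

variable {S : LeviFlatStructure E L} (c : DefiningCouple S)

theorem dbarVec_HLin_X (V W : S.TField) : S.dbarVec V (c.HLin c.X W) =
    (1 / 4 : ℝ) • (S.br V (c.T c.X W) - S.br (S.Jsec V) (c.T c.X (S.Jsec W))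
      + S.Jsec (S.br (S.Jsec V) (c.T c.X W) + S.br V (c.T c.X (S.Jsec W)))) := by
  rw [HLin_apply, map_smul, map_add, S.dbarVec_Jsec_right]
  simp only [S.dbarVec_apply, S.smul_Jsec, map_add, AlmostLeviFlat.Jsec_Jsec]
  module

/-- `∂̄H = θ^{0,1} ∧ H`, evaluated on `V` and `W`. -/
theorem dbarVec_HLin_X_sub (V W : S.TField) :
    S.dbarVec V (c.HLin c.X W) - S.dbarVec W (c.HLin c.X V) - c.HLin c.X (S.bracket01 V W) =
      (1 / 2 : ℝ) • (c.theta V • c.HLin c.X W + c.theta (S.Jsec V) • S.Jsec (c.HLin c.X W))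
      - (1 / 2 : ℝ) •
        (c.theta W • c.HLin c.X V + c.theta (S.Jsec W) • S.Jsec (c.HLin c.X V)) := by
  rw [dbarVec_HLin_X, dbarVec_HLin_X]
  simp only [HLin_apply]
  -- `module` does not compare the images of `1 / 4` and `1 / 2` in `C^∞(L)`
  have h4 : (1 / 4 : ℝ) = 1 / 2 * (1 / 2) := by norm_num
  rw [S.Jsec_bracket01, S.bracket01_apply, h4]
  simp only [map_smul, map_add, map_sub, S.smul_Jsec, T_X_br, AlmostLeviFlat.Jsec_Jsec]
  module

/-- `∂̄(fH) = (δf)^{0,1} ∧ H`. -/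
theorem dbar_wedgeH_zero (f : c.Z 0) :
    S.dbar 1 (c.wedgeH 0 f) = c.wedgeH 1 (c.delta 0 f) := by
  refine Subtype.ext (AlternatingMap.ext fun v => ?_)
  have hv : v = ![v 0, v 1] := by ext1 i; fin_cases i <;> rfl
  generalize v 0 = V at hv
  generalize v 1 = W at hv
  have hw : ∀ U, (c.wedgeH 0 f).1 ![U] = f.1 ![] • c.HLin c.X U :=
    S.wedgeZero_zero_apply (c.H c.X) f.1
  have hH : ∀ U, (c.H c.X).1 ![U] = c.HLin c.X U := fun _ => rfl
  -- the Leibniz rule for `∂̄` reduces the claim to `f` times the formula for `∂̄H`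
  have key := congrArg (fun U => f.1 ![] • U) (c.dbarVec_HLin_X_sub V W)
  rw [hv, S.dbar_one_apply]
  change _ = (S.wedgeZero (c.H c.X) 1 (c.delta 0 f).1).1 ![V, W]
  rw [S.wedgeZero_one_apply, S.zeroPart_one_apply, S.zeroPart_one_apply]
  simp only [hw, hH, delta_zero_incl, S.dbarVec_smul_right]
  simp only [smul_sub] at key
  rw [sub_eq_iff_eq_add, sub_eq_iff_eq_add] at key
  rw [key]
  module

theorem diff_diff_zero (a : c.Cochain 0) : c.diff 1 (c.diff 0 a) = 0 := by
  refine Cochain.ext (c.delta_delta_zero _) ?_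
  change S.dbar 1 (S.dbar 0 (c.vecPart 0 a) + (-1 : ℝ) ^ 1 • c.wedgeH 0 (c.formPart 0 a)) +
    (-1 : ℝ) ^ 2 • c.wedgeH 1 (c.delta 0 (c.formPart 0 a)) = 0
  rw [map_add, map_smul, S.dbar_dbar_zero, dbar_wedgeH_zero]
  module

end DefiningCouple

end DiffSquared

/-! ### The infinitesimal action of vector fields as the image of `𝔡⁰` -/

section InfAction

variable {E L : Type*} [NormedAddCommGroup E] [NormedSpace ℝ E] [CompleteSpace E]
  [TopologicalSpace L] [ChartedSpace E L] [IsManifold 𝓘(ℝ, E) ∞ L]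

namespace DefiningCouple

variable {S : LeviFlatStructure E L} (c : DefiningCouple S)

theorem ker_diff_one : LinearMap.ker (c.diff 1) = c.infDef := by
  ext a
  rw [LinearMap.mem_ker, mem_infDef]
  have h : c.diff 1 a = Cochain.mk (c.delta 1 (c.formPart 1 a))
    (S.dbar 1 (c.vecPart 1 a) + (-1 : ℝ) ^ 2 • c.wedgeH 1 (c.formPart 1 a)) := rfl
  rw [h, neg_one_sq, one_smul, ← add_eq_zero_iff_eq_neg]
  exact Prod.mk_eq_zero

/-- `H_{W + fX} = ∂̄W + fH` for `W` tangent to `ξ`. The derivative of `f` does not contribute, as the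
projection along `X` kills it. -/
theorem HLin_incl_add_smul (W : S.TField) (f : SmoothFun E L) (V : S.TField) :
    c.HLin (S.incl W + f • c.X) V = S.dbarVec V W + f • c.HLin c.X V := by
  have hT : ∀ V, c.T (S.incl W + f • c.X) V = S.br V W + f • c.T c.X V := fun V => by
    rw [T_apply, map_add, map_add, bracket_smul_right, map_add, map_smul, map_smul, proj_X,
      ← S.incl_br, proj_incl, T_apply, smul_zero, zero_add]
  simp only [HLin_apply, S.dbarVec_apply, hT, map_add, map_smul]
  module

/-- For `Y = W + fX` with `W` tangent to `ξ`, the infinitesimal action of `Y` is `𝔡⁰(f, -W)`. -/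
theorem infAction_eq_diff (Y : VField E L) : c.infAction Y = c.diff 0 (Cochain.mk (c.gammaFun Y)
    ⟨constOfIsEmpty _ _ (Fin 0) (-c.proj Y), S.mem_zeroForm_zero _⟩) := by
  refine Cochain.ext rfl (Subtype.ext (AlternatingMap.ext fun v => ?_))
  have hv : v = ![v 0] := by ext1 i; fin_cases i; rfl
  generalize v 0 = V at hv
  rw [hv]
  change -c.HLin Y V = (S.dbar 0 _).1 ![V] + (-1 : ℝ) ^ 1 • (S.wedgeZero (c.H c.X) 0 _).1 ![V]
  rw [S.dbar_zero_apply, S.wedgeZero_zero_apply]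
  change _ = S.dbarVec V (-c.proj Y) + (-1 : ℝ) ^ 1 • (c.gammaLin Y • c.HLin c.X V)
  conv_lhs => rw [c.eq_incl_proj_add Y, HLin_incl_add_smul]
  rw [map_neg]
  module

theorem range_infAction : LinearMap.range c.infAction = LinearMap.range (c.diff 0) := by
  refine le_antisymm ?_ ?_
  · rintro _ ⟨Y, rfl⟩
    exact ⟨_, (c.infAction_eq_diff Y).symm⟩
  · rintro _ ⟨a, rfl⟩
    refine ⟨S.incl (-(c.vecPart 0 a).1 ![]) + (c.formPart 0 a).1 ![] • c.X, ?_⟩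
    rw [infAction_eq_diff]
    congr 1
    refine Cochain.ext (Subtype.ext (AlternatingMap.ext fun v => ?_))
      (Subtype.ext (AlternatingMap.ext fun v => ?_))
    · rw [Subsingleton.elim v ![]]
      change c.gammaLin _ = _
      rw [map_add, gammaLin_incl, map_smul, gammaLin_X]
      simp
    · rw [Subsingleton.elim v ![]]
      change -c.proj _ = _
      rw [map_add, proj_incl, map_smul, proj_X]
      simp

end DefiningCouple

end InfAction

end LeviFlat

end

theorem mainTheorem1 {n : ℕ} {L : Type*} [TopologicalSpace L] [T2Space L]
    [SecondCountableTopology L] [ChartedSpace (EuclideanSpace ℝ (Fin n)) L]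
    [IsManifold 𝓘(ℝ, EuclideanSpace ℝ (Fin n)) ∞ L]
    (S : LeviFlat.LeviFlatStructure (EuclideanSpace ℝ (Fin n)) L)
    (c : LeviFlat.DefiningCouple S) :
    (∀ a : c.Cochain 0, c.diff 1 (c.diff 0 a) = 0) ∧
    (∀ Y : LeviFlat.VField (EuclideanSpace ℝ (Fin n)) L, c.infAction Y ∈ c.infDef) ∧
    (∀ a a' : c.infDef,
      (Submodule.Quotient.mk a : c.InfModuli) = Submodule.Quotient.mk a' ↔
        c.GaugeEquiv a.1 a'.1) ∧
    ∃ F : c.InfModuli ≃ₗ[ℝ] c.H1, ∀ a : c.infDef, ∃ h : a.1 ∈ LinearMap.ker (c.diff 1),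
      F (Submodule.Quotient.mk a) = Submodule.Quotient.mk ⟨a.1, h⟩ := by
  refine ⟨c.diff_diff_zero, fun Y => ?_, c.infModuli_mk_eq_mk, ?_⟩
  · rw [← c.ker_diff_one, LinearMap.mem_ker, c.infAction_eq_diff, c.diff_diff_zero]
  · refine ⟨Submodule.Quotient.equiv _ _ (LinearEquiv.ofEq _ _ c.ker_diff_one.symm) ?_,
      fun a => ⟨c.ker_diff_one.symm ▸ a.2, rfl⟩⟩
    rw [c.range_infAction]
    ext x
    constructor
    · rintro ⟨y, hy, rfl⟩
      exact hy
    · intro hx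
      exact ⟨⟨x.1, c.ker_diff_one ▸ x.2⟩, hx, rfl⟩
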